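/- **Conventions.** All fibrations and opfibrations are cloven (equipped with chosen liftings). $\mathbf{Fib}$ denotes the following 2-category. Its objects are fibrations. A 1-arrow $F:p\to q$ is a pair of functors $F=(F_b,F_t)$, $F_b$ between the base categories and $F_t$ between the total categories, with $qF_t=F_bp$ (no preservation of cartesian arrows is required). A 2-arrow $\varphi:F\Rightarrow F'$ is a pair of natural transformations $\varphi_b:F_b\Rightarrow F'_b$, $\varphi_t:F_t\Rightarrow F'_t$ with $q(\varphi_{t,X})=\varphi_{b,p(X)}$. A 1-arrow $F$ between opfibrations is *cocartesian* if $F_t$ preserves cocartesian arrows. $\mathbf{biFib}_c$ is the 2-category of bifibrations, cocartesian 1-arrows and all 2-arrows between them. A (bi)fibration $p:E\to B$ *has finite products* if $E$ and $B$ have chosen finite products and $p$ sends the chosen products, projections and terminal object of $E$ to those of $B$. A *strong monad* on such a $p$ is a 1-arrow $T:p\to p$ with 2-arrows $\eta:\mathrm{Id}\Rightarrow T$, $\mu:TT\Rightarrow T$ and $\mathrm{st}:F^T\Rightarrow G^T$, where $F^T,G^T:p\times p\to p$ are given by $$F^T_b(I,J)=I\times T_bJ,\quad F^T_t(X,Y)=X\times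 T_tY,\quad G^T_b(I,J)=T_b(I\times J),\quad G^T_t(X,Y)=T_t(X\times Y),$$ such that $(T_b,\eta_b,\mu_b,\mathrm{st}_b)$ and $(T_t,\eta_t,\mu_t,\mathrm{st}_t)$ satisfy the usual laws of a strong monad. It is a strong monad *in* $\mathbf{biFib}_c$ if $p$ is a bifibration and $T$ is cocartesian. **Differential relations.** Let $p:E\to B$ be a fibration whose base has finite products. An object $X$ of $\mathrm{DRel}(p)$ is a triple $(|X|,dX,\delta X)$ with $|X|,dX\in B$ and $\delta X\in E$ over $|X|\times dX\times|X|$. Put $DX=|X|\times dX$. An arrow $X\to Y$ is a triple $(f,g,h)$ with $f:|X|\to|Y|$, $g:DX\to DY$ such that $\pi_1 g=f\pi_1$, and $h:\delta X\to\delta Y$ in $E$ over $g\times f$; composition is componentwise. $\mathrm{GDS}_p:\mathrm{DRel}(p)\to B$ is the functor $X\mapsto|X|$, $(f,g,h)\mapsto f$. If $p$ has finite products, then so does $\mathrm{GDS}_p$: $$|X\times Y|=|X|\times|Y|,\quad d(X\times Y)=dX\times dY,\quad \delta(X\times Y)=\sigma^*(\delta X\times\delta Y),$$ where $\sigma:\nabla(X\times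 Y)\to\nabla X\times\nabla Y$ is the canonical isomorphism and $\nabla X=|X|\times dX\times|X|$. **Liftings.** Let $F:p\to q$ be a 1-arrow, where $q$ is an opfibration and the bases have finite products. Let $\hat F X=(F_b|X|,\,F_b(DX),\,s_!(F_t\,\delta X))$, where $s=\langle F_b\pi_1,F_b\langle\pi_1,\pi_2\rangle,F_b\pi_3\rangle: F_b(|X|\times dX\times|X|)\to F_b|X|\times F_b(DX)\times F_b|X|$ and $\kappa^F_X:F_t\,\delta X\to s_!(F_t\,\delta X)$ is the chosen cocartesian arrow over $s$. Let $\hat F(f,g,h)=(F_bf,\;F_bf\times F_bg,\;h')$, where $h'$ is the unique arrow over $(F_bf\times F_bg)\times F_bf$ with $h'\kappa^F_X=\kappa^F_Y\,F_t(h)$. This makes $(F_b,\hat F)$ a 1-arrow $\mathrm{GDS}_p\to\mathrm{GDS}_q$. For a 2-arrow $\varphi:F\Rightarrow F'$, let $\hat\varphi_X:\hat FX\to\hat F'X$ have first component $\varphi_{b,|X|}$, second component $\varphi_{b,|X|}\times\varphi_{b,DX}$, and third component $h'$ with $h'\kappa^F_X=\kappa^{F'}_X\varphi_{t,\delta X}$.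 Moreover: * $\xi_X:X\to\widehat{\mathrm{Id}}X$ is $(\mathrm{id},\langle\pi_1,\mathrm{id}_{DX}\rangle,\kappa^{\mathrm{Id}}_X)$. * $\omega_X:\hat T\hat TX\to\widehat{TT}X$ (for $T$ cocartesian) has first component $\mathrm{id}$, second component $\mathrm{id}\times T_b\pi_2$, where $\pi_2:T_b|X|\times T_b(DX)\to T_b(DX)$, and third component $h'$ with $h'\,\kappa^{T}_{\hat TX}\,T_t(\kappa^T_X)=\kappa^{TT}_X$. For differential relations $X,Y$ in $p$, let $(X,Y)$ denote the differential relation $((|X|,|Y|),(dX,dY),(\delta X,\delta Y))$ in $p\times p$. Let $\tau:DX\times DY\to D(X\times Y)$ be the canonical isomorphism, and $\rho_{X,Y}:\delta X\times\delta Y\to\delta(X\times Y)$ the inverse of the cartesian arrow over $\sigma$. * $\zeta_{X,Y}:\hat G^T(X,Y)\to\hat T(X\times Y)$ has first component $\mathrm{id}$, second component $\mathrm{id}\times T_b\tau$, and third component $h'$ with $h'\kappa^{G^T}_{(X,Y)}=\kappa^T_{X\times Y}\,T_t(\rho_{X,Y})$. * $\zeta'_{X,Y}:\widehat{\mathrm{Id}}X\times\hat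 TY\to\hat F^T(X,Y)$ (when $\times$ on $E$ preserves cocartesian arrows) has identities as first and second components, and third component $h'$ with $h'\,\rho_{\widehat{\mathrm{Id}}X,\hat TY}\,(\kappa^{\mathrm{Id}}_X\times\kappa^T_Y)=\kappa^{F^T}_{(X,Y)}$. **Theorem.** Let $p:E\to B$ be a bifibration with finite products such that the product functor $\times:E\times E\to E$ preserves cocartesian arrows: if $f$ and $g$ are cocartesian for $p$, then so is $f\times g$. Let $(T,\eta,\mu,\mathrm{st})$ be a strong monad on $p$ in $\mathbf{biFib}_c$. Then: 1. $\mathrm{GDS}_p$ is a fibration. 2. $\zeta$ and $\zeta'$ are natural in $X$ and $Y$ (with respect to arrows of $\mathrm{DRel}(p)$), and every $\zeta_{X,Y}$ and $\zeta'_{X,Y}$ is a vertical isomorphism, i.e. an isomorphism over an identity of $B$. 3. The 1-arrow $(T_b,\hat T):\mathrm{GDS}_p\to\mathrm{GDS}_p$ with unit $(\eta_b,\hat\eta\circ\xi)$, multiplication $(\mu_b,\hat\mu\circ\omega)$ and strength $(\mathrm{st}_b,\mathrm{st}')$, where $$\mathrm{st}'_{X,Y}=\zeta_{X,Y}\circ\widehat{\mathrm{st}}_{(X,Y)}\circ\zeta'_{X,Y}\circ(\xi_X\times\mathrm{id}_{\hat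 TY}):\;X\times\hat TY\to\hat T(X\times Y),$$ is a strong monad on $\mathrm{GDS}_p$ in $\mathbf{Fib}$. -/

import Mathlib

open CategoryTheory MonoidalCategory CartesianMonoidalCategory

universe v₁ v₂ v₃ v₄ v₅ v₆ u₁ u₂ u₃ u₄ u₅ u₆

namespace DiffRel

/-! ### Cloven (bi)fibrations -/

section Fibrations

variable {B : Type u₁} [Category.{v₁} B] {E : Type u₂} [Category.{v₂} E]

/-- A fibration `p`, given with a choice of cartesian liftings. -/
class Cleavage (p : E ⥤ B) where
  /-- the domain of the chosen cartesian arrow over `u` with codomain `X` -/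
  obj {I J : B} (u : I ⟶ J) (X : E) (h : p.obj X = J) : E
  /-- the chosen cartesian arrow over `u` with codomain `X` -/
  map {I J : B} (u : I ⟶ J) (X : E) (h : p.obj X = J) : obj u X h ⟶ X
  isCartesian {I J : B} (u : I ⟶ J) (X : E) (h : p.obj X = J) :
    p.IsStronglyCartesian u (map u X h)

/-- An opfibration `p`, given with a choice of cocartesian liftings. -/
class Opcleavage (p : E ⥤ B) where
  /-- the codomain of the chosen cocartesian arrow over `u` with domain `X` -/
  obj {I J : B} (u : I ⟶ J) (X : E) (h : p.obj X = I) : E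
  /-- the chosen cocartesian arrow over `u` with domain `X` -/
  map {I J : B} (u : I ⟶ J) (X : E) (h : p.obj X = I) : X ⟶ obj u X h
  isCocartesian {I J : B} (u : I ⟶ J) (X : E) (h : p.obj X = I) :
    p.IsStronglyCocartesian u (map u X h)

attribute [instance] Cleavage.isCartesian Opcleavage.isCocartesian

/-- The functor `p` strictly preserves the chosen finite products of `E` and `B`: the chosen
product diagrams of `E` lie over the chosen product diagrams of `B`. -/
class StrictFiniteProducts (p : E ⥤ B) [CartesianMonoidalCategory B]
    [CartesianMonoidalCategory E] : Prop where
  obj_unit : p.obj (𝟙_ E) = 𝟙_ B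
  lift_fst (X Y : E) : p.IsHomLift (fst (p.obj X) (p.obj Y)) (fst X Y)
  lift_snd (X Y : E) : p.IsHomLift (snd (p.obj X) (p.obj Y)) (snd X Y)

/-- The product functor on the total category preserves cocartesian arrows. -/
def ProductPreservesCocartesian (p : E ⥤ B) [CartesianMonoidalCategory E] : Prop :=
  ∀ ⦃X X' Y Y' : E⦄ (f : X ⟶ X') (g : Y ⟶ Y'),
    p.IsStronglyCocartesian (p.map f) f → p.IsStronglyCocartesian (p.map g) g →
      p.IsStronglyCocartesian (p.map (f ⊗ₘ g)) (f ⊗ₘ g)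

end Fibrations

/-! ### 1-arrows and 2-arrows between fibrations -/

section Arrows

variable {B : Type u₁} [Category.{v₁} B] {E : Type u₂} [Category.{v₂} E]
variable {C : Type u₃} [Category.{v₃} C] {D : Type u₄} [Category.{v₄} D]
variable {H : Type u₅} [Category.{v₅} H] {G : Type u₆} [Category.{v₆} G]

/-- A 1-arrow from `p` to `q`: a functor between the bases and a functor between the domains
making the square commute (no preservation of cartesian arrows is required). -/
structure OneArrow (p : E ⥤ B) (q : D ⥤ C) where
  /-- the functor between the bases -/
  b : B ⥤ C
  /-- the functor between the domains -/
  t : E ⥤ D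
  comm : t ⋙ q = p ⋙ b

namespace OneArrow

variable {p : E ⥤ B} {q : D ⥤ C} {r : G ⥤ H}

theorem comm_obj (F : OneArrow p q) (X : E) : q.obj (F.t.obj X) = F.b.obj (p.obj X) :=
  Functor.congr_obj F.comm X

theorem comm_obj' (F : OneArrow p q) {X : E} {I : B} (h : p.obj X = I) :
    q.obj (F.t.obj X) = F.b.obj I := by
  subst h; exact F.comm_obj X

theorem isHomLift (F : OneArrow p q) {I J : B} (u : I ⟶ J) {X Y : E} (f : X ⟶ Y)
    [p.IsHomLift u f] : q.IsHomLift (F.b.map u) (F.t.map f) := by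
  obtain ⟨⟩ := (inferInstance : p.IsHomLift u f)
  refine IsHomLift.of_fac' _ _ _ (F.comm_obj _) (F.comm_obj _) ?_
  exact Functor.congr_hom F.comm f

/-- The identity 1-arrow. -/
@[reducible] def id (p : E ⥤ B) : OneArrow p p where
  b := 𝟭 B
  t := 𝟭 E
  comm := rfl

/-- The composite of 1-arrows: first `F`, then `G`. -/
@[reducible] def comp (F : OneArrow p q) (G : OneArrow q r) : OneArrow p r where
  b := F.b ⋙ G.b
  t := F.t ⋙ G.t
  comm := by
    rw [Functor.assoc, G.comm, ← Functor.assoc, F.comm, Functor.assoc]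

/-- A 1-arrow is cocartesian if its functor between domains preserves cocartesian arrows. -/
def IsCocartesian (F : OneArrow p q) : Prop :=
  ∀ ⦃X Y : E⦄ (f : X ⟶ Y), p.IsStronglyCocartesian (p.map f) f →
    q.IsStronglyCocartesian (q.map (F.t.map f)) (F.t.map f)

end OneArrow

/-- A 2-arrow between 1-arrows: a natural transformation between the functors on the bases and one
between the functors on the domains, the latter lying over the former. -/
structure TwoArrow {p : E ⥤ B} {q : D ⥤ C} (F F' : OneArrow p q) where
  /-- the natural transformation between the functors on the bases -/
  b : F.b ⟶ F'.b
  /-- the natural transformation between the functors on the domains -/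
  t : F.t ⟶ F'.t
  lifts (X : E) : q.IsHomLift (b.app (p.obj X)) (t.app X)

end Arrows

/-! ### Strong monads -/

section StrongMonads

/-- The component `X × T Y ⟶ T (X × Y)` of a natural transformation `- × T - ⟶ T (- × -)`. -/
def strengthApp {C : Type u₁} [Category.{v₁} C] [CartesianMonoidalCategory C] {T : C ⥤ C}
    (st : (𝟭 C).prod T ⋙ tensor C ⟶ tensor C ⋙ T) (X Y : C) :
    X ⊗ T.obj Y ⟶ T.obj (X ⊗ Y) :=
  st.app (X, Y)

/-- `(T, η, μ, st)` is a strong monad on a category with (chosen) finite products. -/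
structure IsStrongMonad {C : Type u₁} [Category.{v₁} C] [CartesianMonoidalCategory C]
    (T : C ⥤ C) (η : 𝟭 C ⟶ T) (μ : T ⋙ T ⟶ T)
    (st : (𝟭 C).prod T ⋙ tensor C ⟶ tensor C ⋙ T) : Prop where
  left_unit (X : C) : η.app (T.obj X) ≫ μ.app X = 𝟙 (T.obj X)
  right_unit (X : C) : T.map (η.app X) ≫ μ.app X = 𝟙 (T.obj X)
  assoc (X : C) : T.map (μ.app X) ≫ μ.app X = μ.app (T.obj X) ≫ μ.app X
  strength_unit (X : C) : strengthApp st (𝟙_ C) X ≫ T.map (λ_ X).hom = (λ_ (T.obj X)).hom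
  strength_assoc (X Y Z : C) :
    strengthApp st (X ⊗ Y) Z ≫ T.map (α_ X Y Z).hom =
      (α_ X Y (T.obj Z)).hom ≫ (X ◁ strengthApp st Y Z) ≫ strengthApp st X (Y ⊗ Z)
  strength_eta (X Y : C) : (X ◁ η.app Y) ≫ strengthApp st X Y = η.app (X ⊗ Y)
  strength_mu (X Y : C) :
    (X ◁ μ.app Y) ≫ strengthApp st X Y =
      strengthApp st X (T.obj Y) ≫ T.map (strengthApp st X Y) ≫ μ.app (X ⊗ Y)

variable {B : Type u₁} [Category.{v₁} B] [CartesianMonoidalCategory B]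
variable {E : Type u₂} [Category.{v₂} E] [CartesianMonoidalCategory E]
variable {p : E ⥤ B}

theorem isHomLift_lift [StrictFiniteProducts p] {I J K : B} {Z X Y : E}
    (u : K ⟶ I) (v : K ⟶ J) (f : Z ⟶ X) (g : Z ⟶ Y) [p.IsHomLift u f] [p.IsHomLift v g] :
    p.IsHomLift (lift u v) (lift f g) := by
  have hZ : p.obj Z = K := IsHomLift.domain_eq p u f
  obtain rfl : p.obj X = I := IsHomLift.codomain_eq p u f
  obtain rfl : p.obj Y = J := IsHomLift.codomain_eq p v g
  subst hZ
  have h₁ := StrictFiniteProducts.lift_fst (p := p) X Y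
  have h₂ := StrictFiniteProducts.lift_snd (p := p) X Y
  have hXY : p.obj (X ⊗ Y) = p.obj X ⊗ p.obj Y := IsHomLift.domain_eq p (fst (p.obj X) (p.obj Y)) (fst X Y)
  refine IsHomLift.of_fac' _ _ _ rfl hXY ?_
  have e₁ : u = p.map f := IsHomLift.eq_of_isHomLift p _ _
  have e₂ : v = p.map g := IsHomLift.eq_of_isHomLift p _ _
  rw [eqToHom_refl, Category.id_comp, ← cancel_mono (eqToHom hXY)]
  simp only [Category.assoc, eqToHom_trans, eqToHom_refl, Category.comp_id]
  have f₁ := IsHomLift.fac p (fst (p.obj X) (p.obj Y)) (fst X Y)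
  have f₂ := IsHomLift.fac p (snd (p.obj X) (p.obj Y)) (snd X Y)
  simp only [eqToHom_refl, Category.comp_id] at f₁ f₂
  apply CartesianMonoidalCategory.hom_ext
  · rw [lift_fst, Category.assoc, e₁, f₁]
    simp [← Functor.map_comp]
  · rw [lift_snd, Category.assoc, e₂, f₂]
    simp [← Functor.map_comp]

theorem isHomLift_tensor [StrictFiniteProducts p] {I I' J J' : B} {X X' Y Y' : E}
    (u : I ⟶ I') (v : J ⟶ J') (f : X ⟶ X') (g : Y ⟶ Y') [p.IsHomLift u f] [p.IsHomLift v g] :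
    p.IsHomLift (u ⊗ₘ v) (f ⊗ₘ g) := by
  obtain ⟨⟩ := (inferInstance : p.IsHomLift u f)
  obtain ⟨⟩ := (inferInstance : p.IsHomLift v g)
  have h₁ := StrictFiniteProducts.lift_fst (p := p) X Y
  have h₂ := StrictFiniteProducts.lift_snd (p := p) X Y
  rw [← lift_fst_comp_snd_comp, ← lift_fst_comp_snd_comp]
  exact isHomLift_lift _ _ _ _

theorem obj_tensor [StrictFiniteProducts p] {I J : B} {X Y : E} (hX : p.obj X = I)
    (hY : p.obj Y = J) : p.obj (X ⊗ Y) = I ⊗ J := by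
  subst hX hY
  have h₁ := StrictFiniteProducts.lift_fst (p := p) X Y
  exact IsHomLift.domain_eq p (fst (p.obj X) (p.obj Y)) (fst X Y)

theorem tensor_comm (p : E ⥤ B) [StrictFiniteProducts p] :
    tensor E ⋙ p = p.prod p ⋙ tensor B := by
  refine CategoryTheory.Functor.ext (fun X => obj_tensor rfl rfl) (fun X Y f => ?_)
  have h := isHomLift_tensor (p := p) (p.map f.1) (p.map f.2) f.1 f.2
  exact IsHomLift.fac' p (p.map f.1 ⊗ₘ p.map f.2) (f.1 ⊗ₘ f.2)

variable [StrictFiniteProducts p]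

/-- The 1-arrow `(I, J) ↦ I × T J`, `(X, Y) ↦ X × T Y` from `p × p` to `p`. -/
@[reducible] def strengthDom (T : OneArrow p p) : OneArrow (p.prod p) p where
  b := (𝟭 B).prod T.b ⋙ tensor B
  t := (𝟭 E).prod T.t ⋙ tensor E
  comm := by
    rw [Functor.assoc, tensor_comm, ← Functor.assoc, ← Functor.assoc]
    congr 1
    change Functor.prod p (T.t ⋙ p) = Functor.prod p (p ⋙ T.b)
    rw [T.comm]

/-- The 1-arrow `(I, J) ↦ T (I × J)`, `(X, Y) ↦ T (X × Y)` from `p × p` to `p`. -/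
@[reducible] def strengthCod (T : OneArrow p p) : OneArrow (p.prod p) p where
  b := tensor B ⋙ T.b
  t := tensor E ⋙ T.t
  comm := by
    rw [Functor.assoc, T.comm, ← Functor.assoc, tensor_comm, Functor.assoc]

/-- The structure of a strong monad, on a fibration `p` with finite products, whose underlying
1-arrow is `T`: a unit, a multiplication and a strength, which are 2-arrows, and which form
strong monads both on the base and on the domain of `p`. -/
structure StrongMonad (p : E ⥤ B) [StrictFiniteProducts p] (T : OneArrow p p) where
  /-- the unit -/
  η : TwoArrow (OneArrow.id p) T
  /-- the multiplication -/
  μ : TwoArrow (T.comp T) T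
  /-- the strength -/
  st : TwoArrow (strengthDom T) (strengthCod T)
  isStrongMonad_b : IsStrongMonad T.b η.b μ.b st.b
  isStrongMonad_t : IsStrongMonad T.t η.t μ.t st.t

end StrongMonads

/-! ### The fibration of differential relations -/

section DifferentialRelations

variable {B : Type u₁} [Category.{v₁} B] [CartesianMonoidalCategory B]
variable {E : Type u₂} [Category.{v₂} E]

/-- Differential relations in `p`: objects `pt` and `dist` of the base, and an object `rel` in the
fibre over `pt × dist × pt`. -/
structure DRelCat (p : E ⥤ B) where
  /-- the object of points -/
  pt : B
  /-- the object of distances -/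
  dist : B
  /-- the relation -/
  rel : E
  obj_rel : p.obj rel = (pt ⊗ dist) ⊗ pt

namespace DRelCat

variable {p : E ⥤ B}

/-- `|X| × dist X`. -/
abbrev D (X : DRelCat p) : B := X.pt ⊗ X.dist

/-- `|X| × dist X × |X|`. -/
abbrev nabla (X : DRelCat p) : B := X.D ⊗ X.pt

/-- Arrows of differential relations. -/
@[ext] structure Hom (X Y : DRelCat p) where
  /-- the arrow on points -/
  pt : X.pt ⟶ Y.pt
  /-- the arrow on points and distances -/
  der : X.D ⟶ Y.D
  /-- the arrow on relations -/
  rel : X.rel ⟶ Y.rel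
  der_fst : der ≫ fst Y.pt Y.dist = fst X.pt X.dist ≫ pt := by cat_disch
  lifts : p.IsHomLift (der ⊗ₘ pt) rel

attribute [instance] Hom.lifts
attribute [simp] Hom.der_fst

@[simp] theorem Hom.der_fst_assoc {X Y : DRelCat p} (f : Hom X Y) {Z : B} (k : Y.pt ⟶ Z) :
    f.der ≫ fst Y.pt Y.dist ≫ k = fst X.pt X.dist ≫ f.pt ≫ k := by
  rw [← Category.assoc, f.der_fst, Category.assoc]

theorem isHomLift_id (X : DRelCat p) : p.IsHomLift (𝟙 X.nabla) (𝟙 X.rel) :=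
  IsHomLift.id X.obj_rel

@[simps id_pt id_der id_rel comp_pt comp_der comp_rel] instance instCategory : Category (DRelCat p) where
  Hom := Hom
  id X :=
    { pt := 𝟙 _
      der := 𝟙 _
      rel := 𝟙 _
      lifts := by rw [id_tensorHom_id]; exact X.isHomLift_id }
  comp f g :=
    { pt := f.pt ≫ g.pt
      der := f.der ≫ g.der
      rel := f.rel ≫ g.rel
      lifts := by rw [← tensorHom_comp_tensorHom]; infer_instance }

@[ext] theorem hom_ext {X Y : DRelCat p} {f g : X ⟶ Y} (h₁ : f.pt = g.pt) (h₂ : f.der = g.der)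
    (h₃ : f.rel = g.rel) : f = g :=
  Hom.ext h₁ h₂ h₃

end DRelCat

/-- The functor `X ↦ |X|` from differential relations in `p` to the base of `p`. -/
@[simps] def GDS (p : E ⥤ B) : DRelCat p ⥤ B where
  obj X := X.pt
  map f := f.pt


/-! #### Finite products -/

section Products

variable [CartesianMonoidalCategory E] {p : E ⥤ B}

namespace DRelCat

/-- The canonical arrow from `(I × J) × (V × W) × (I × J)` to `(I × V × I) × (J × W × J)`. -/
def shuffle (I V J W : B) :
    ((I ⊗ J) ⊗ (V ⊗ W)) ⊗ (I ⊗ J) ⟶ ((I ⊗ V) ⊗ I) ⊗ ((J ⊗ W) ⊗ J) :=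
  lift ((fst I J ⊗ₘ fst V W) ⊗ₘ fst I J) ((snd I J ⊗ₘ snd V W) ⊗ₘ snd I J)

/-- The canonical arrow from `(A × B) × (C × D)` to `(A × C) × (B × D)`. -/
def interchange (I V J W : B) : (I ⊗ V) ⊗ (J ⊗ W) ⟶ (I ⊗ J) ⊗ (V ⊗ W) :=
  lift (fst I V ⊗ₘ fst J W) (snd I V ⊗ₘ snd J W)

/-- The canonical arrow from `(I × V × I) × (J × W × J)` to `(I × J) × (V × W) × (I × J)`. -/
def unshuffle (I V J W : B) :
    ((I ⊗ V) ⊗ I) ⊗ ((J ⊗ W) ⊗ J) ⟶ ((I ⊗ J) ⊗ (V ⊗ W)) ⊗ (I ⊗ J) :=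
  lift ((fst (I ⊗ V) I ⊗ₘ fst (J ⊗ W) J) ≫ interchange I V J W)
    (snd (I ⊗ V) I ⊗ₘ snd (J ⊗ W) J)

theorem shuffle_unshuffle (I V J W : B) : shuffle I V J W ≫ unshuffle I V J W = 𝟙 _ := by
  simp only [shuffle, unshuffle, interchange]
  ext <;> simp

theorem unshuffle_shuffle (I V J W : B) : unshuffle I V J W ≫ shuffle I V J W = 𝟙 _ := by
  simp only [shuffle, unshuffle, interchange]
  ext <;> simp

theorem shuffle_fst (I V J W : B) :
    shuffle I V J W ≫ fst _ _ = (fst I J ⊗ₘ fst V W) ⊗ₘ fst I J := by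
  simp only [shuffle, lift_fst]

theorem shuffle_snd (I V J W : B) :
    shuffle I V J W ≫ snd _ _ = (snd I J ⊗ₘ snd V W) ⊗ₘ snd I J := by
  simp only [shuffle, lift_snd]

theorem lift_tensor_shuffle {K U I V J W : B} (a : K ⊗ U ⟶ I ⊗ V) (b : K ⊗ U ⟶ J ⊗ W)
    (c : K ⟶ I) (d : K ⟶ J) :
    lift (a ⊗ₘ c) (b ⊗ₘ d) =
      ((lift a b ≫ interchange I V J W) ⊗ₘ lift c d) ≫ shuffle I V J W := by
  simp only [shuffle, interchange]
  ext <;> simp [-associator_conjugation]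

theorem lift_interchange_fst {K U I V J W : B} (a : K ⊗ U ⟶ I ⊗ V) (b : K ⊗ U ⟶ J ⊗ W)
    (c : K ⟶ I) (d : K ⟶ J) (ha : a ≫ fst I V = fst K U ≫ c) (hb : b ≫ fst J W = fst K U ≫ d) :
    (lift a b ≫ interchange I V J W) ≫ fst (I ⊗ J) (V ⊗ W) = fst K U ≫ lift c d := by
  simp only [interchange]
  ext <;> simp [ha, hb]

theorem isHomLift_fst [StrictFiniteProducts p] (X Y : DRelCat p) :
    p.IsHomLift (fst X.nabla Y.nabla) (fst X.rel Y.rel) := by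
  have := StrictFiniteProducts.lift_fst (p := p) X.rel Y.rel
  rwa [X.obj_rel, Y.obj_rel] at this

theorem isHomLift_snd [StrictFiniteProducts p] (X Y : DRelCat p) :
    p.IsHomLift (snd X.nabla Y.nabla) (snd X.rel Y.rel) := by
  have := StrictFiniteProducts.lift_snd (p := p) X.rel Y.rel
  rwa [X.obj_rel, Y.obj_rel] at this

theorem isHomLift_toUnit [StrictFiniteProducts p] {Z : DRelCat p} : p.IsHomLift (toUnit Z.nabla) (toUnit Z.rel) := by
  refine IsHomLift.of_fac' p _ _ Z.obj_rel StrictFiniteProducts.obj_unit ?_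
  rw [← cancel_mono (eqToHom (StrictFiniteProducts.obj_unit (p := p)))]
  exact toUnit_unique _ _

variable [Cleavage p] [StrictFiniteProducts p]

/-- The terminal differential relation. -/
@[reducible] def unit (p : E ⥤ B) [Cleavage p] [StrictFiniteProducts p] : DRelCat p where
  pt := 𝟙_ B
  dist := 𝟙_ B
  rel := Cleavage.obj (p := p) (toUnit ((𝟙_ B ⊗ 𝟙_ B) ⊗ 𝟙_ B)) (𝟙_ E)
    StrictFiniteProducts.obj_unit
  obj_rel := IsHomLift.domain_eq p (toUnit ((𝟙_ B ⊗ 𝟙_ B) ⊗ 𝟙_ B)) (Cleavage.map _ _ _)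

/-- The product of differential relations. -/
@[reducible] def prod (X Y : DRelCat p) : DRelCat p where
  pt := X.pt ⊗ Y.pt
  dist := X.dist ⊗ Y.dist
  rel := Cleavage.obj (p := p) (shuffle X.pt X.dist Y.pt Y.dist) (X.rel ⊗ Y.rel)
    (obj_tensor X.obj_rel Y.obj_rel)
  obj_rel := IsHomLift.domain_eq p (shuffle X.pt X.dist Y.pt Y.dist) (Cleavage.map _ _ _)

/-- The chosen cartesian arrow from the relation of a product to the product of the relations. -/
def prodRel (X Y : DRelCat p) : (prod X Y).rel ⟶ X.rel ⊗ Y.rel :=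
  Cleavage.map (p := p) (shuffle X.pt X.dist Y.pt Y.dist) (X.rel ⊗ Y.rel)
    (obj_tensor X.obj_rel Y.obj_rel)

instance prodRel_cartesian (X Y : DRelCat p) :
    p.IsStronglyCartesian (shuffle X.pt X.dist Y.pt Y.dist) (prodRel X Y) :=
  Cleavage.isCartesian _ _ _

/-- The arrow from the product of the relations to the relation of the product, whose composite
with the chosen cartesian arrow is the identity. -/
noncomputable def relProd (X Y : DRelCat p) : X.rel ⊗ Y.rel ⟶ (prod X Y).rel :=
  haveI : p.IsHomLift (𝟙 (X.nabla ⊗ Y.nabla)) (𝟙 (X.rel ⊗ Y.rel)) :=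
    IsHomLift.id (obj_tensor X.obj_rel Y.obj_rel)
  Functor.IsStronglyCartesian.map p (shuffle X.pt X.dist Y.pt Y.dist) (prodRel X Y)
    (unshuffle_shuffle X.pt X.dist Y.pt Y.dist).symm (𝟙 (X.rel ⊗ Y.rel))

theorem isHomLift_relProd (X Y : DRelCat p) :
    p.IsHomLift (unshuffle X.pt X.dist Y.pt Y.dist) (relProd X Y) := by
  have : p.IsHomLift (𝟙 (X.nabla ⊗ Y.nabla)) (𝟙 (X.rel ⊗ Y.rel)) :=
    IsHomLift.id (obj_tensor X.obj_rel Y.obj_rel)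
  exact Functor.IsStronglyCartesian.map_isHomLift p _ _
    (unshuffle_shuffle X.pt X.dist Y.pt Y.dist).symm _

theorem relProd_prodRel (X Y : DRelCat p) : relProd X Y ≫ prodRel X Y = 𝟙 _ := by
  have : p.IsHomLift (𝟙 (X.nabla ⊗ Y.nabla)) (𝟙 (X.rel ⊗ Y.rel)) :=
    IsHomLift.id (obj_tensor X.obj_rel Y.obj_rel)
  exact Functor.IsStronglyCartesian.fac p _ _
    (unshuffle_shuffle X.pt X.dist Y.pt Y.dist).symm _

instance isIso_shuffle (I V J W : B) : IsIso (shuffle I V J W) :=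
  ⟨unshuffle I V J W, shuffle_unshuffle I V J W, unshuffle_shuffle I V J W⟩

instance isIso_relProd (X Y : DRelCat p) : IsIso (relProd X Y) := by
  have := Functor.IsStronglyCartesian.isIso_of_base_isIso p (shuffle X.pt X.dist Y.pt Y.dist)
    (prodRel X Y)
  have h : relProd X Y = inv (prodRel X Y) := IsIso.eq_inv_of_inv_hom_id (relProd_prodRel X Y)
  rw [h]
  infer_instance

/-- The first projection. -/
@[simps] def prodFst (X Y : DRelCat p) : prod X Y ⟶ X where
  pt := fst X.pt Y.pt
  der := fst X.pt Y.pt ⊗ₘ fst X.dist Y.dist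
  rel := prodRel X Y ≫ fst X.rel Y.rel
  der_fst := by simp
  lifts := by
    have := isHomLift_fst X Y
    rw [← shuffle_fst]; infer_instance

/-- The second projection. -/
@[simps] def prodSnd (X Y : DRelCat p) : prod X Y ⟶ Y where
  pt := snd X.pt Y.pt
  der := snd X.pt Y.pt ⊗ₘ snd X.dist Y.dist
  rel := prodRel X Y ≫ snd X.rel Y.rel
  der_fst := by simp
  lifts := by
    have := isHomLift_snd X Y
    rw [← shuffle_snd]; infer_instance

/-- The pairing of two arrows. -/
@[simps] noncomputable def prodLift {X Y Z : DRelCat p} (f : Z ⟶ X) (g : Z ⟶ Y) :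
    Z ⟶ prod X Y where
  pt := lift f.pt g.pt
  der := lift f.der g.der ≫ interchange X.pt X.dist Y.pt Y.dist
  rel :=
    haveI := isHomLift_lift (p := p) (f.der ⊗ₘ f.pt) (g.der ⊗ₘ g.pt) f.rel g.rel
    Functor.IsStronglyCartesian.map p (shuffle X.pt X.dist Y.pt Y.dist) (prodRel X Y)
      (lift_tensor_shuffle f.der g.der f.pt g.pt) (lift f.rel g.rel)
  der_fst := lift_interchange_fst _ _ _ _ f.der_fst g.der_fst
  lifts := by infer_instance

theorem prodLift_rel_prodRel {X Y Z : DRelCat p} (f : Z ⟶ X) (g : Z ⟶ Y) :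
    (prodLift f g).rel ≫ prodRel X Y = lift f.rel g.rel := by
  have := isHomLift_lift (p := p) (f.der ⊗ₘ f.pt) (g.der ⊗ₘ g.pt) f.rel g.rel
  exact Functor.IsStronglyCartesian.fac p _ _
    (lift_tensor_shuffle f.der g.der f.pt g.pt) (lift f.rel g.rel)

/-- The arrow into the terminal differential relation. -/
@[simps] noncomputable def toUnit' (Z : DRelCat p) : Z ⟶ unit p where
  pt := toUnit Z.pt
  der := toUnit Z.pt ⊗ₘ toUnit Z.dist
  rel :=
    haveI := isHomLift_toUnit (p := p) (Z := Z)
    haveI : p.IsStronglyCartesian (toUnit ((𝟙_ B ⊗ 𝟙_ B) ⊗ 𝟙_ B)) _ :=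
      Cleavage.isCartesian (p := p) _ (𝟙_ E) StrictFiniteProducts.obj_unit
    Functor.IsStronglyCartesian.map p (toUnit ((𝟙_ B ⊗ 𝟙_ B) ⊗ 𝟙_ B))
      (Cleavage.map (p := p) (toUnit ((𝟙_ B ⊗ 𝟙_ B) ⊗ 𝟙_ B)) (𝟙_ E)
        StrictFiniteProducts.obj_unit)
      (toUnit_unique (toUnit Z.nabla) (((toUnit Z.pt ⊗ₘ toUnit Z.dist) ⊗ₘ toUnit Z.pt) ≫ toUnit _))
      (toUnit Z.rel)
  der_fst := by simp
  lifts := by infer_instance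

open Limits

/-- The terminal differential relation is terminal. -/
noncomputable def isTerminalUnit : IsTerminal (unit p) :=
  IsTerminal.ofUniqueHom toUnit' fun Z m => by
    have h₁ : m.pt = (toUnit' Z).pt := toUnit_unique _ _
    have h₂ : m.der = (toUnit' Z).der :=
      CartesianMonoidalCategory.hom_ext _ _ (toUnit_unique _ _) (toUnit_unique _ _)
    refine DRelCat.hom_ext h₁ h₂ ?_
    have : p.IsStronglyCartesian (toUnit ((𝟙_ B ⊗ 𝟙_ B) ⊗ 𝟙_ B)) _ :=
      Cleavage.isCartesian (p := p) _ (𝟙_ E) StrictFiniteProducts.obj_unit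
    have hm : p.IsHomLift ((toUnit' Z).der ⊗ₘ (toUnit' Z).pt) m.rel := by
      rw [← h₁, ← h₂]; exact m.lifts
    have := (toUnit' Z).lifts
    exact Functor.IsStronglyCartesian.ext p (toUnit ((𝟙_ B ⊗ 𝟙_ B) ⊗ 𝟙_ B))
      (Cleavage.map (p := p) (toUnit ((𝟙_ B ⊗ 𝟙_ B) ⊗ 𝟙_ B)) (𝟙_ E)
        StrictFiniteProducts.obj_unit) ((toUnit' Z).der ⊗ₘ (toUnit' Z).pt) (toUnit_unique _ _)

theorem prod_hom_ext {X Y Z : DRelCat p} {f g : Z ⟶ prod X Y}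
    (h₁ : f ≫ prodFst X Y = g ≫ prodFst X Y) (h₂ : f ≫ prodSnd X Y = g ≫ prodSnd X Y) :
    f = g := by
  have a₁ := congrArg Hom.pt h₁
  have a₂ := congrArg Hom.pt h₂
  have b₁ := congrArg Hom.der h₁
  have b₂ := congrArg Hom.der h₂
  have c₁ := congrArg Hom.rel h₁
  have c₂ := congrArg Hom.rel h₂
  have hpt : f.pt = g.pt := CartesianMonoidalCategory.hom_ext _ _ a₁ a₂
  have hder : f.der = g.der := by
    refine CartesianMonoidalCategory.hom_ext _ _ ?_ ?_
    · rw [f.der_fst, g.der_fst, hpt]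
    · refine CartesianMonoidalCategory.hom_ext _ _ ?_ ?_
      · simpa using congrArg (· ≫ snd X.pt X.dist) b₁
      · simpa using congrArg (· ≫ snd Y.pt Y.dist) b₂
  refine DRelCat.hom_ext hpt hder ?_
  have hg : p.IsHomLift (f.der ⊗ₘ f.pt) g.rel := by rw [hpt, hder]; exact g.lifts
  have hf := f.lifts
  refine Functor.IsStronglyCartesian.ext p (shuffle X.pt X.dist Y.pt Y.dist) (prodRel X Y)
    (f.der ⊗ₘ f.pt) ?_
  refine CartesianMonoidalCategory.hom_ext _ _ ?_ ?_
  · simpa using c₁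
  · simpa using c₂

theorem prodLift_fst {X Y Z : DRelCat p} (f : Z ⟶ X) (g : Z ⟶ Y) :
    prodLift f g ≫ prodFst X Y = f := by
  refine DRelCat.hom_ext ?_ ?_ ?_
  · simp
  · refine Eq.trans ?_ (lift_comp_fst_snd f.der)
    simp [interchange]
  · simp

theorem prodLift_snd {X Y Z : DRelCat p} (f : Z ⟶ X) (g : Z ⟶ Y) :
    prodLift f g ≫ prodSnd X Y = g := by
  refine DRelCat.hom_ext ?_ ?_ ?_
  · simp
  · refine Eq.trans ?_ (lift_comp_fst_snd g.der)
    simp [interchange]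
  · simp

/-- The binary products of differential relations. -/
@[reducible] noncomputable def prodLimitCone (X Y : DRelCat p) : LimitCone (pair X Y) where
  cone := BinaryFan.mk (prodFst X Y) (prodSnd X Y)
  isLimit := BinaryFan.IsLimit.mk _ prodLift prodLift_fst prodLift_snd
    (fun f g _ hf hg => prod_hom_ext (hf.trans (prodLift_fst f g).symm)
      (hg.trans (prodLift_snd f g).symm))

end DRelCat

variable [Cleavage p] [StrictFiniteProducts p]

/-- The chosen finite products of differential relations. -/
noncomputable instance : CartesianMonoidalCategory (DRelCat p) :=
  CartesianMonoidalCategory.ofChosenFiniteProducts ⟨_, DRelCat.isTerminalUnit⟩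
    DRelCat.prodLimitCone

theorem fst_pt (X Y : DRelCat p) : (fst X Y : X ⊗ Y ⟶ X).pt = fst X.pt Y.pt := rfl

instance : StrictFiniteProducts (GDS p) where
  obj_unit := rfl
  lift_fst X Y := .map (fst X Y)
  lift_snd X Y := .map (snd X Y)

end Products

end DifferentialRelations

/-! ### Products of fibrations -/

section ProductFibration

open scoped CategoryTheory.Prod

variable {B : Type u₁} [Category.{v₁} B] {C : Type u₃} [Category.{v₃} C]
variable {E : Type u₂} [Category.{v₂} E] {D : Type u₄} [Category.{v₄} D]

theorem isHomLift_prod {p : E ⥤ B} {q : D ⥤ C} {I J : B} {K L : C} {X Y : E} {Z W : D}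
    (u : I ⟶ J) (v : K ⟶ L) (f : X ⟶ Y) (g : Z ⟶ W) [p.IsHomLift u f] [q.IsHomLift v g] :
    (p.prod q).IsHomLift (u ×ₘ v) (f ×ₘ g) := by
  obtain ⟨⟩ := (inferInstance : p.IsHomLift u f)
  obtain ⟨⟩ := (inferInstance : q.IsHomLift v g)
  exact .map (p := p.prod q) (f ×ₘ g)

theorem isStronglyCocartesian_of_isHomLift {p : E ⥤ B} {I J : B} {X Y : E}
    (u : I ⟶ J) (f : X ⟶ Y) (hf : p.IsStronglyCocartesian (p.map f) f) [p.IsHomLift u f] :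
    p.IsStronglyCocartesian u f := by
  obtain ⟨⟩ := (inferInstance : p.IsHomLift u f)
  exact hf

theorem isStronglyCocartesian_comp {p : E ⥤ B} {I J K : B} {X Y Z : E} {u : I ⟶ J} {v : J ⟶ K}
    {f : X ⟶ Y} {g : Y ⟶ Z} (hf : p.IsStronglyCocartesian u f)
    (hg : p.IsStronglyCocartesian v g) : p.IsStronglyCocartesian (u ≫ v) (f ≫ g) :=
  Functor.IsStronglyCocartesian.comp p

theorem OneArrow.IsCocartesian.map {p : E ⥤ B} {q : D ⥤ C} {F : OneArrow p q}
    (hF : F.IsCocartesian)  {I J : B} {X Y : E} (u : I ⟶ J) (f : X ⟶ Y)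
    [hf : p.IsStronglyCocartesian u f] :
    q.IsStronglyCocartesian (F.b.map u) (F.t.map f) := by
  have := F.isHomLift u f
  obtain ⟨⟩ := (inferInstance : p.IsHomLift u f)
  exact isStronglyCocartesian_of_isHomLift _ _ (hF f hf)

variable [CartesianMonoidalCategory B] [CartesianMonoidalCategory C]

/-- The componentwise finite products of a product of categories. -/
instance prodCartesianMonoidal : CartesianMonoidalCategory (B × C) where
  toMonoidalCategory := prodMonoidal B C
  isTerminalTensorUnit := Limits.IsTerminal.ofUniqueHom
    (fun X => toUnit X.1 ×ₘ toUnit X.2)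
    (fun _ _ => Prod.ext (toUnit_unique _ _) (toUnit_unique _ _))
  fst X Y := (fst X.1 Y.1) ×ₘ (fst X.2 Y.2)
  snd X Y := (snd X.1 Y.1) ×ₘ (snd X.2 Y.2)
  tensorProductIsBinaryProduct _ _ := Limits.BinaryFan.IsLimit.mk _
    (fun f g => (lift f.1 g.1) ×ₘ (lift f.2 g.2))
    (fun _ _ => Prod.ext (lift_fst _ _) (lift_fst _ _))
    (fun _ _ => Prod.ext (lift_snd _ _) (lift_snd _ _))
    (fun _ _ _ hf hg => Prod.ext
      (CartesianMonoidalCategory.hom_ext _ _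
        ((congrArg Prod.fst hf).trans (lift_fst _ _).symm)
        ((congrArg Prod.fst hg).trans (lift_snd _ _).symm))
      (CartesianMonoidalCategory.hom_ext _ _
        ((congrArg Prod.snd hf).trans (lift_fst _ _).symm)
        ((congrArg Prod.snd hg).trans (lift_snd _ _).symm)))
  fst_def _ _ := Prod.ext (fst_def _ _) (fst_def _ _)
  snd_def _ _ := Prod.ext (snd_def _ _) (snd_def _ _)

/-- A differential relation in `p` and one in `q` form a differential relation in `p × q`. -/
@[reducible] def DRelCat.pair {p : E ⥤ B} {q : D ⥤ C} (X : DRelCat p) (Y : DRelCat q) :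
    DRelCat (p.prod q) where
  pt := (X.pt, Y.pt)
  dist := (X.dist, Y.dist)
  rel := (X.rel, Y.rel)
  obj_rel := congrArg₂ Prod.mk X.obj_rel Y.obj_rel

/-- The action of `DRelCat.pair` on arrows. -/
@[simps] def DRelCat.pairMap {p : E ⥤ B} {q : D ⥤ C} {X X' : DRelCat p} {Y Y' : DRelCat q}
    (f : X ⟶ X') (g : Y ⟶ Y') : X.pair Y ⟶ X'.pair Y' where
  pt := f.pt ×ₘ g.pt
  der := f.der ×ₘ g.der
  rel := f.rel ×ₘ g.rel
  der_fst := Prod.ext f.der_fst g.der_fst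
  lifts := isHomLift_prod (f.der ⊗ₘ f.pt) (g.der ⊗ₘ g.pt) f.rel g.rel

end ProductFibration

/-! ### The action on 1-arrows and 2-arrows -/

section Lifting

variable {B : Type u₁} [Category.{v₁} B] [CartesianMonoidalCategory B]
variable {E : Type u₂} [Category.{v₂} E]
variable {C : Type u₃} [Category.{v₃} C] [CartesianMonoidalCategory C]
variable {D : Type u₄} [Category.{v₄} D]
variable {A : Type u₅} [Category.{v₅} A] [CartesianMonoidalCategory A]
variable {G : Type u₆} [Category.{v₆} G]
variable {p : E ⥤ B} {q : D ⥤ C} {r : G ⥤ A}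

/-- The arrow `⟨K π₁, K ⟨π₁, π₂⟩, K π₃⟩` from `K (I × V × I)` to `K I × K (I × V) × K I`. -/
def splitArrow (K : B ⥤ C) (I V : B) :
    K.obj ((I ⊗ V) ⊗ I) ⟶ (K.obj I ⊗ K.obj (I ⊗ V)) ⊗ K.obj I :=
  lift (lift (K.map (fst (I ⊗ V) I ≫ fst I V)) (K.map (fst (I ⊗ V) I)))
    (K.map (snd (I ⊗ V) I))

theorem splitArrow_naturality {K K' : B ⥤ C} (φ : K ⟶ K') {I V I' V' : B}
    (d : I ⊗ V ⟶ I' ⊗ V') (u : I ⟶ I') (h : d ≫ fst I' V' = fst I V ≫ u) :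
    (φ.app ((I ⊗ V) ⊗ I) ≫ K'.map (d ⊗ₘ u)) ≫ splitArrow K' I' V' =
      splitArrow K I V ≫
        (((φ.app I ≫ K'.map u) ⊗ₘ (φ.app (I ⊗ V) ≫ K'.map d)) ⊗ₘ (φ.app I ≫ K'.map u)) := by
  simp only [splitArrow]
  ext <;> simp [-associator_conjugation, ← Functor.map_comp, h]

/-- The arrow `X ⟶ Z` whose third component is induced, through the universal property of a
cocartesian arrow `c` into the relation of `X`, by an arrow `a` into the relation of `Z`. -/
@[simps] noncomputable def DRelCat.desc {X Z : DRelCat p} {I : B} {W : E} (w : I ⟶ X.nabla)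
    (c : W ⟶ X.rel) (hc : p.IsStronglyCocartesian w c) (u : X.pt ⟶ Z.pt) (d : X.D ⟶ Z.D)
    (hd : d ≫ fst Z.pt Z.dist = fst X.pt X.dist ≫ u) (v : I ⟶ Z.nabla)
    (hv : v = w ≫ (d ⊗ₘ u)) (a : W ⟶ Z.rel) (ha : p.IsHomLift v a) : X ⟶ Z where
  pt := u
  der := d
  rel := Functor.IsStronglyCocartesian.map p w c hv a
  der_fst := hd
  lifts := by infer_instance

theorem DRelCat.fac_desc {X Z : DRelCat p} {I : B} {W : E} (w : I ⟶ X.nabla)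
    (c : W ⟶ X.rel) (hc : p.IsStronglyCocartesian w c) (u : X.pt ⟶ Z.pt) (d : X.D ⟶ Z.D)
    (hd : d ≫ fst Z.pt Z.dist = fst X.pt X.dist ≫ u) (v : I ⟶ Z.nabla)
    (hv : v = w ≫ (d ⊗ₘ u)) (a : W ⟶ Z.rel) (ha : p.IsHomLift v a) :
    c ≫ (DRelCat.desc w c hc u d hd v hv a ha).rel = a :=
  Functor.IsStronglyCocartesian.fac p w c hv a

namespace OneArrow

variable [Opcleavage q] (F : OneArrow p q)

/-- The action of the lifting of a 1-arrow on objects. -/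
@[reducible] def hatObj (X : DRelCat p) : DRelCat q where
  pt := F.b.obj X.pt
  dist := F.b.obj (X.pt ⊗ X.dist)
  rel := Opcleavage.obj (p := q) (splitArrow F.b X.pt X.dist) (F.t.obj X.rel)
    (F.comm_obj' X.obj_rel)
  obj_rel := IsHomLift.codomain_eq q (splitArrow F.b X.pt X.dist) (Opcleavage.map _ _ _)

/-- The chosen cocartesian arrow from `F (rel X)` to the relation of the lifting. -/
def hatRel (X : DRelCat p) : F.t.obj X.rel ⟶ (F.hatObj X).rel :=
  Opcleavage.map (p := q) (splitArrow F.b X.pt X.dist) (F.t.obj X.rel) (F.comm_obj' X.obj_rel)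

instance hatRel_cocartesian (X : DRelCat p) :
    q.IsStronglyCocartesian (splitArrow F.b X.pt X.dist) (F.hatRel X) :=
  Opcleavage.isCocartesian _ _ _

variable {F}

/-- The arrow between liftings over `u` whose third component is induced by an arrow `a` over `v`,
through the universal property of the cocartesian arrow `hatRel`. -/
noncomputable def hatHom {F' : OneArrow p q} {X Y : DRelCat p}
    (u : F.b.obj X.pt ⟶ F'.b.obj Y.pt) (d : F.b.obj X.D ⟶ F'.b.obj Y.D)
    (v : F.b.obj X.nabla ⟶ F'.b.obj Y.nabla)
    (h : v ≫ splitArrow F'.b Y.pt Y.dist = splitArrow F.b X.pt X.dist ≫ ((u ⊗ₘ d) ⊗ₘ u))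
    (a : F.t.obj X.rel ⟶ F'.t.obj Y.rel) (ha : q.IsHomLift v a) :
    F.hatObj X ⟶ F'.hatObj Y :=
  DRelCat.desc (X := F.hatObj X) (Z := F'.hatObj Y) (splitArrow F.b X.pt X.dist) (F.hatRel X)
    inferInstance u (u ⊗ₘ d) (tensorHom_fst _ _) (v ≫ splitArrow F'.b Y.pt Y.dist) h
    (a ≫ F'.hatRel Y) inferInstance

section

variable {F' : OneArrow p q} {X Y : DRelCat p}
    (u : F.b.obj X.pt ⟶ F'.b.obj Y.pt) (d : F.b.obj X.D ⟶ F'.b.obj Y.D)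
    (v : F.b.obj X.nabla ⟶ F'.b.obj Y.nabla)
    (h : v ≫ splitArrow F'.b Y.pt Y.dist = splitArrow F.b X.pt X.dist ≫ ((u ⊗ₘ d) ⊗ₘ u))
    (a : F.t.obj X.rel ⟶ F'.t.obj Y.rel) (ha : q.IsHomLift v a)

@[simp] theorem hatHom_pt : (hatHom u d v h a ha).pt = u := rfl

@[simp] theorem hatHom_der : (hatHom u d v h a ha).der = u ⊗ₘ d := rfl

theorem hatRel_hatHom :
    F.hatRel X ≫ (hatHom u d v h a ha).rel = a ≫ F'.hatRel Y :=
  DRelCat.fac_desc _ _ _ _ _ _ _ _ _ _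

theorem hatRel_hatHom_assoc {W : D} (k : (F'.hatObj Y).rel ⟶ W) :
    F.hatRel X ≫ (hatHom u d v h a ha).rel ≫ k = a ≫ F'.hatRel Y ≫ k := by
  rw [← Category.assoc, hatRel_hatHom, Category.assoc]

end

theorem hat_hom_ext {X : DRelCat p} {Z : DRelCat q} {f g : F.hatObj X ⟶ Z} (h₁ : f.pt = g.pt)
    (h₂ : f.der = g.der) (h₃ : F.hatRel X ≫ f.rel = F.hatRel X ≫ g.rel) : f = g := by
  refine DRelCat.hom_ext h₁ h₂ ?_
  have hg : q.IsHomLift (f.der ⊗ₘ f.pt) g.rel := by rw [h₁, h₂]; exact g.lifts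
  have hf := f.lifts
  exact Functor.IsStronglyCocartesian.ext q (splitArrow F.b X.pt X.dist) (F.hatRel X)
    (f.der ⊗ₘ f.pt) h₃

variable (F)

/-- The lifting of a 1-arrow to a functor between the categories of differential relations. -/
@[reducible] noncomputable def hat : DRelCat p ⥤ DRelCat q where
  obj X := F.hatObj X
  map {X Y} f := hatHom (F.b.map f.pt) (F.b.map f.der) (F.b.map (f.der ⊗ₘ f.pt))
    (by simpa using splitArrow_naturality (𝟙 F.b) f.der f.pt f.der_fst)
    (F.t.map f.rel) (F.isHomLift _ _)
  map_id X := by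
    refine hat_hom_ext ?_ ?_ ?_
    · simp
    · simp
    · rw [hatRel_hatHom]; simp
  map_comp f g := by
    refine hat_hom_ext ?_ ?_ ?_
    · simp
    · simp
    · rw [hatRel_hatHom, DRelCat.comp_rel]
      erw [hatRel_hatHom_assoc]
      rw [hatRel_hatHom]
      simp

/-- The action on 1-arrows: from `F : p ⟶ q` to a 1-arrow between the fibrations of differential
relations. -/
@[reducible] noncomputable def dRel : OneArrow (GDS p) (GDS q) where
  b := F.b
  t := F.hat
  comm := rfl

end OneArrow

/-- The lifting of a 2-arrow. -/
noncomputable def TwoArrow.hatApp [Opcleavage q] {F F' : OneArrow p q} (φ : TwoArrow F F')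
    (X : DRelCat p) : F.hat.obj X ⟶ F'.hat.obj X :=
  OneArrow.hatHom (φ.b.app X.pt) (φ.b.app X.D) (φ.b.app X.nabla)
    (by simpa using splitArrow_naturality φ.b (𝟙 X.D) (𝟙 X.pt) (by simp))
    (φ.t.app X.rel) (by have := φ.lifts X.rel; rwa [X.obj_rel] at this)

theorem splitArrow_id (I V : B) :
    splitArrow (𝟭 B) I V = lift (fst I V) (𝟙 (I ⊗ V)) ⊗ₘ 𝟙 I := by
  simp only [splitArrow]
  ext <;> simp

/-- The arrow `ξ` from `X` to the lifting of the identity 1-arrow at `X`. -/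
noncomputable def xi [Opcleavage p] (X : DRelCat p) : X ⟶ (OneArrow.id p).hatObj X where
  pt := 𝟙 X.pt
  der := lift (fst X.pt X.dist) (𝟙 X.D)
  rel := (OneArrow.id p).hatRel X
  der_fst := (lift_fst _ _).trans (Category.comp_id _).symm
  lifts := (splitArrow_id X.pt X.dist) ▸ ((OneArrow.id p).hatRel_cocartesian X).toIsHomLift

theorem splitArrow_comp (F : B ⥤ C) (K : C ⥤ A) (I V : B) :
    splitArrow (F ⋙ K) I V =
      (K.map (splitArrow F I V) ≫ splitArrow K (F.obj I) (F.obj (I ⊗ V))) ≫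
        ((𝟙 (K.obj (F.obj I)) ⊗ₘ K.map (snd (F.obj I) (F.obj (I ⊗ V)))) ⊗ₘ
          𝟙 (K.obj (F.obj I))) := by
  simp only [splitArrow]
  ext <;> simp [-associator_conjugation, ← Functor.map_comp]

/-- The arrow `ω` from the composite of the liftings of `F` and `K` to the lifting of their
composite, where `K` is cocartesian. -/
noncomputable def omega [Opcleavage q] [Opcleavage r] (F : OneArrow p q) (K : OneArrow q r)
    (hK : K.IsCocartesian) (X : DRelCat p) :
    K.hatObj (F.hatObj X) ⟶ (F.comp K).hatObj X :=
  haveI := hK.map (splitArrow F.b X.pt X.dist) (F.hatRel X)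
  haveI := K.hatRel_cocartesian (F.hatObj X)
  DRelCat.desc
    (K.b.map (splitArrow F.b X.pt X.dist) ≫
      splitArrow K.b (F.hatObj X).pt (F.hatObj X).dist)
    (K.t.map (F.hatRel X) ≫ K.hatRel (F.hatObj X))
    (Functor.IsStronglyCocartesian.comp r)
    (𝟙 _) (𝟙 _ ⊗ₘ K.b.map (snd (F.hatObj X).pt (F.hatObj X).dist)) (tensorHom_fst _ _)
    (splitArrow (F.comp K).b X.pt X.dist) (splitArrow_comp F.b K.b X.pt X.dist)
    ((F.comp K).hatRel X) ((F.comp K).hatRel_cocartesian X).toIsHomLift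

end Lifting

/-! ### The lifted strength -/

section Strength

variable {B : Type u₁} [Category.{v₁} B] [CartesianMonoidalCategory B]
variable {E : Type u₂} [Category.{v₂} E] [CartesianMonoidalCategory E]

open DRelCat

theorem ProductPreservesCocartesian.tensor {p : E ⥤ B} [StrictFiniteProducts p]
    (hp : ProductPreservesCocartesian p)
    {I I' J J' : B} {X X' Y Y' : E} (u : I ⟶ I') (v : J ⟶ J') (f : X ⟶ X') (g : Y ⟶ Y')
    [hf : p.IsStronglyCocartesian u f] [hg : p.IsStronglyCocartesian v g] :
    p.IsStronglyCocartesian (u ⊗ₘ v) (f ⊗ₘ g) := by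
  have := isHomLift_tensor (p := p) u v f g
  obtain ⟨⟩ := (inferInstance : p.IsHomLift u f)
  obtain ⟨⟩ := (inferInstance : p.IsHomLift v g)
  exact isStronglyCocartesian_of_isHomLift _ _ (hp f g hf hg)

variable {p : E ⥤ B} [StrictFiniteProducts p]

theorem splitArrow_strengthCod_eq (T : OneArrow p p) (I V J W : B) :
    splitArrow (strengthCod T).b (I, J) (V, W) =
      lift (lift (T.b.map ((fst (I ⊗ V) I ≫ fst I V) ⊗ₘ (fst (J ⊗ W) J ≫ fst J W)))
        (T.b.map (fst (I ⊗ V) I ⊗ₘ fst (J ⊗ W) J)))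
        (T.b.map (snd (I ⊗ V) I ⊗ₘ snd (J ⊗ W) J)) := rfl

theorem splitArrow_strengthDom_eq (T : OneArrow p p) (I V J W : B) :
    splitArrow (strengthDom T).b (I, J) (V, W) =
      lift (lift ((fst (I ⊗ V) I ≫ fst I V) ⊗ₘ T.b.map (fst (J ⊗ W) J ≫ fst J W))
        (fst (I ⊗ V) I ⊗ₘ T.b.map (fst (J ⊗ W) J)))
        (snd (I ⊗ V) I ⊗ₘ T.b.map (snd (J ⊗ W) J)) := rfl

theorem unshuffle_fst_fst (I V J W : B) :
    unshuffle I V J W ≫ fst _ _ ≫ fst _ _ =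
      (fst (I ⊗ V) I ≫ fst I V) ⊗ₘ (fst (J ⊗ W) J ≫ fst J W) := by
  simp only [unshuffle, interchange]
  ext <;> simp

theorem unshuffle_fst (I V J W : B) :
    unshuffle I V J W ≫ fst _ _ = (fst (I ⊗ V) I ⊗ₘ fst (J ⊗ W) J) ≫ interchange I V J W := by
  simp only [unshuffle, lift_fst]

theorem unshuffle_snd (I V J W : B) :
    unshuffle I V J W ≫ snd _ _ = snd (I ⊗ V) I ⊗ₘ snd (J ⊗ W) J := by
  simp only [unshuffle, lift_snd]

theorem splitArrow_strengthCod (T : OneArrow p p) (I V J W : B) :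
    T.b.map (unshuffle I V J W) ≫ splitArrow T.b (I ⊗ J) (V ⊗ W) =
      splitArrow (strengthCod T).b (I, J) (V, W) ≫
        ((𝟙 (T.b.obj (I ⊗ J)) ⊗ₘ T.b.map (interchange I V J W)) ⊗ₘ 𝟙 (T.b.obj (I ⊗ J))) := by
  rw [splitArrow_strengthCod_eq, lift_map, lift_map]
  simp only [splitArrow, comp_lift, ← Functor.map_comp, unshuffle_fst, unshuffle_snd,
    unshuffle_fst_fst, Category.comp_id]

theorem splitArrow_strengthDom (T : OneArrow p p) (I V J W : B) :
    splitArrow (strengthDom T).b (I, J) (V, W) =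
      ((splitArrow (𝟭 B) I V ⊗ₘ splitArrow T.b J W) ≫
        unshuffle I (I ⊗ V) (T.b.obj J) (T.b.obj (J ⊗ W))) ≫
        (𝟙 ((I ⊗ T.b.obj J) ⊗ ((I ⊗ V) ⊗ T.b.obj (J ⊗ W))) ⊗ₘ 𝟙 (I ⊗ T.b.obj J)) := by
  rw [splitArrow_strengthDom_eq]
  simp only [splitArrow, unshuffle, interchange]
  ext <;> simp

variable [Cleavage p]

theorem isStronglyCocartesian_relProd (X Y : DRelCat p) :
    p.IsStronglyCocartesian (unshuffle X.pt X.dist Y.pt Y.dist) (relProd X Y) :=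
  haveI := isHomLift_relProd X Y
  Functor.IsStronglyCocartesian.of_isIso p _ _

variable [Opcleavage p]

/-- The vertical arrow `ζ`. -/
noncomputable def zeta (T : OneArrow p p) (X Y : DRelCat p) :
    (strengthCod T).hatObj (X.pair Y) ⟶ T.hatObj (X ⊗ Y) :=
  DRelCat.desc (splitArrow (strengthCod T).b (X.pair Y).pt (X.pair Y).dist)
    ((strengthCod T).hatRel (X.pair Y)) ((strengthCod T).hatRel_cocartesian (X.pair Y))
    (𝟙 (T.b.obj (X.pt ⊗ Y.pt)))
    (𝟙 (T.b.obj (X.pt ⊗ Y.pt)) ⊗ₘ T.b.map (interchange X.pt X.dist Y.pt Y.dist))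
    (tensorHom_fst _ _)
    (T.b.map (unshuffle X.pt X.dist Y.pt Y.dist) ≫
      splitArrow T.b (X.pt ⊗ Y.pt) (X.dist ⊗ Y.dist))
    (splitArrow_strengthCod T X.pt X.dist Y.pt Y.dist)
    (T.t.map (relProd X Y) ≫ T.hatRel (X ⊗ Y))
    (by
      have := isHomLift_relProd X Y
      have := T.isHomLift (unshuffle X.pt X.dist Y.pt Y.dist) (relProd X Y)
      have := (T.hatRel_cocartesian (prod X Y)).toIsHomLift
      exact IsHomLift.comp p (T.b.map (unshuffle X.pt X.dist Y.pt Y.dist))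
        (splitArrow T.b (X.pt ⊗ Y.pt) (X.dist ⊗ Y.dist)) (T.t.map (relProd X Y))
        (T.hatRel (prod X Y)))

/-- The vertical arrow `ζ'`. -/
noncomputable def zeta' (hp : ProductPreservesCocartesian p) (T : OneArrow p p)
    (X Y : DRelCat p) :
    (OneArrow.id p).hatObj X ⊗ T.hatObj Y ⟶ (strengthDom T).hatObj (X.pair Y) :=
  haveI := hp.tensor (splitArrow (OneArrow.id p).b X.pt X.dist) (splitArrow T.b Y.pt Y.dist)
    ((OneArrow.id p).hatRel X) (T.hatRel Y) (hf := (OneArrow.id p).hatRel_cocartesian X)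
    (hg := T.hatRel_cocartesian Y)
  DRelCat.desc
    ((splitArrow (𝟭 B) X.pt X.dist ⊗ₘ splitArrow T.b Y.pt Y.dist) ≫
      unshuffle X.pt (X.pt ⊗ X.dist) (T.b.obj Y.pt) (T.b.obj (Y.pt ⊗ Y.dist)))
    (((OneArrow.id p).hatRel X ⊗ₘ T.hatRel Y) ≫
      relProd ((OneArrow.id p).hatObj X) (T.hatObj Y))
    (isStronglyCocartesian_comp this
      (isStronglyCocartesian_relProd ((OneArrow.id p).hatObj X) (T.hatObj Y)))
    (𝟙 (X.pt ⊗ T.b.obj Y.pt))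
    (𝟙 ((X.pt ⊗ T.b.obj Y.pt) ⊗ ((X.pt ⊗ X.dist) ⊗ T.b.obj (Y.pt ⊗ Y.dist))))
    ((Category.id_comp _).trans (Category.comp_id _).symm)
    (splitArrow (strengthDom T).b (X.pt, Y.pt) (X.dist, Y.dist))
    (splitArrow_strengthDom T X.pt X.dist Y.pt Y.dist)
    ((strengthDom T).hatRel (X.pair Y)) 
    ((strengthDom T).hatRel_cocartesian (X.pair Y)).toIsHomLift

/-- The lifted strength. -/
noncomputable def liftedStrength (hp : ProductPreservesCocartesian p) (T : OneArrow p p)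
    (st : TwoArrow (strengthDom T) (strengthCod T)) (X Y : DRelCat p) :
    X ⊗ T.hatObj Y ⟶ T.hatObj (X ⊗ Y) :=
  (xi X ▷ T.hatObj Y) ≫ zeta' hp T X Y ≫ st.hatApp (X.pair Y) ≫ zeta T X Y

end Strength

end DiffRel

open DiffRel

namespace DiffRel

open DRelCat

/-! An arrow `f : X ⟶ Z` of differential relations is determined by three things: its action on
points, the composite `f.der ≫ snd` (the other projection of `f.der` is forced by `der_fst`), and
the composite of `f.rel` with any cocartesian arrow into `X.rel`. This is
`hom_ext_of_isStronglyCocartesian`. It splits an equation between such arrows into two equations in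
`B`, one on points and one on distances, and one equation in `E`.

The lifted unit, multiplication and strength are used only through three component formulas each. On
points they are the structure of `T.b` at `X.pt`; on distances they are the structure of `T.b` at
`X.D`, up to projections; on relations, composed with the chosen cocartesian arrows, they are the
structure of `T.t` at `X.rel`. Hence each law of the lifted monad follows, by naturality, from the
same law for `T.b` at `X.pt` and at `X.D` and for `T.t` at `X.rel`.

Two facts make this work. The composites used for testing must be cocartesian: for iterated liftings
because `T` is cocartesian, for products because products preserve cocartesian arrows. Moreover `D`
and `rel` preserve binary products up to the isomorphisms `derTensor` and `relTensor`, which are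
compatible with tensored arrows, unitors and associators, so the strength laws can be computed in
`B` and `E`.

The arrows `zeta` and `zeta'` are isomorphisms because they compare two cocartesian arrows and are
invertible on points and distances (`isIso_desc`). `GDS p` is a fibration because a differential
relation can be reindexed in its points, with its distances kept fixed (`existsUnique_reindex`). -/

theorem comp_comp_of_eq {C : Type u₁} [Category.{v₁} C] {X Y Z W : C} {f : X ⟶ Y} {g : Y ⟶ Z}
    {k : X ⟶ Z} (h : f ≫ g = k) (l : Z ⟶ W) : f ≫ g ≫ l = k ≫ l := by
  rw [← Category.assoc, h]

theorem comp_comp_comp_of_eq {C : Type u₁} [Category.{v₁} C] {X Y Z W V : C} {f : X ⟶ Y}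
    {g : Y ⟶ Z} {h : Z ⟶ W} {k : X ⟶ W} (e : f ≫ g ≫ h = k) (l : W ⟶ V) :
    f ≫ g ≫ h ≫ l = k ≫ l := by
  rw [← e, Category.assoc, Category.assoc]

theorem comp_comp_of_sq {C : Type u₁} [Category.{v₁} C] {X Y Y' Z W : C} {f : X ⟶ Y} {g : Y ⟶ Z}
    {f' : X ⟶ Y'} {g' : Y' ⟶ Z} (h : f ≫ g = f' ≫ g') (l : Z ⟶ W) :
    f ≫ g ≫ l = f' ≫ g' ≫ l := by
  rw [← Category.assoc, h, Category.assoc]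

/-! ### Arrows of differential relations -/

section Arrows

variable {B : Type u₁} [Category.{v₁} B] [CartesianMonoidalCategory B]
variable {E : Type u₂} [Category.{v₂} E] {p : E ⥤ B}

/-- Arrows out of a differential relation are determined by their action on points, by the second
component of their action on distances, and by the precomposition of their action on relations
with a cocartesian arrow. -/
theorem DRelCat.hom_ext_of_isStronglyCocartesian {X Z : DRelCat p} {I : B} {W : E}
    {w : I ⟶ X.nabla} {c : W ⟶ X.rel} (hc : p.IsStronglyCocartesian w c) {f g : X ⟶ Z}
    (h₁ : f.pt = g.pt) (h₂ : f.der ≫ snd Z.pt Z.dist = g.der ≫ snd Z.pt Z.dist)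
    (h₃ : c ≫ f.rel = c ≫ g.rel) : f = g := by
  have h : f.der = g.der :=
    CartesianMonoidalCategory.hom_ext _ _ (by rw [f.der_fst, g.der_fst, h₁]) h₂
  refine DRelCat.hom_ext h₁ h ?_
  have hg : p.IsHomLift (f.der ⊗ₘ f.pt) g.rel := by rw [h₁, h]; exact g.lifts
  have hf := f.lifts
  exact Functor.IsStronglyCocartesian.ext p w c (f.der ⊗ₘ f.pt) h₃

theorem DRelCat.isIso_of_components {X Y : DRelCat p} (f : X ⟶ Y) (h₁ : IsIso f.pt)
    (h₂ : IsIso f.der) (h₃ : IsIso f.rel) : IsIso f := by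
  have := f.lifts
  have hl : p.IsHomLift (inv (f.der ⊗ₘ f.pt)) (inv f.rel) := inferInstance
  let g : Y ⟶ X :=
    { pt := inv f.pt
      der := inv f.der
      rel := inv f.rel
      der_fst := by rw [IsIso.inv_comp_eq, f.der_fst_assoc, IsIso.hom_inv_id, Category.comp_id]
      lifts := by rwa [inv_tensor] at hl }
  exact ⟨g, DRelCat.hom_ext (IsIso.hom_inv_id _) (IsIso.hom_inv_id _) (IsIso.hom_inv_id _),
    DRelCat.hom_ext (IsIso.inv_hom_id _) (IsIso.inv_hom_id _) (IsIso.inv_hom_id _)⟩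

/-- An arrow induced by a cocartesian arrow `a` is an isomorphism as soon as its action on points
and distances is. -/
theorem DRelCat.isIso_desc {X Z : DRelCat p} {I : B} {W : E} (w : I ⟶ X.nabla)
    (c : W ⟶ X.rel) (hc : p.IsStronglyCocartesian w c) (u : X.pt ⟶ Z.pt) (d : X.D ⟶ Z.D)
    (hd : d ≫ fst Z.pt Z.dist = fst X.pt X.dist ≫ u) (v : I ⟶ Z.nabla)
    (hv : v = w ≫ (d ⊗ₘ u)) (a : W ⟶ Z.rel) (ha : p.IsHomLift v a) [hu : IsIso u] [hd' : IsIso d]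
    (hca : p.IsStronglyCocartesian v a) : IsIso (DRelCat.desc w c hc u d hd v hv a ha) := by
  refine DRelCat.isIso_of_components _ hu hd' ?_
  -- Cocartesian arrows cancel on the left: `c` and its composite with the induced arrow are
  -- cocartesian, hence so is the induced arrow, which lies over an isomorphism.
  have h₁ : p.IsStronglyCocartesian (w ≫ (d ⊗ₘ u))
      (c ≫ (DRelCat.desc w c hc u d hd v hv a ha).rel) := by
    rw [DRelCat.fac_desc, ← hv]; exact hca
  have h₂ : p.IsHomLift (d ⊗ₘ u) (DRelCat.desc w c hc u d hd v hv a ha).rel :=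
    (DRelCat.desc w c hc u d hd v hv a ha).lifts
  have h₃ : p.IsStronglyCocartesian (d ⊗ₘ u) (DRelCat.desc w c hc u d hd v hv a ha).rel :=
    Functor.IsStronglyCocartesian.of_comp p (f := w) (φ := c)
  exact Functor.IsStronglyCocartesian.isIso_of_base_isIso p (d ⊗ₘ u) _

end Arrows

/-! ### Cartesian liftings of differential relations -/

section Fibration

variable {B : Type u₁} [Category.{v₁} B] [CartesianMonoidalCategory B]
variable {E : Type u₂} [Category.{v₂} E] {p : E ⥤ B} [Cleavage p]

/-- The reindexing of a differential relation along an arrow into its object of points. -/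
@[reducible] def DRelCat.reindex (Y : DRelCat p) {I : B} (u : I ⟶ Y.pt) : DRelCat p where
  pt := I
  dist := Y.dist
  rel := Cleavage.obj (p := p) ((u ⊗ₘ 𝟙 Y.dist) ⊗ₘ u) Y.rel Y.obj_rel
  obj_rel := IsHomLift.domain_eq p ((u ⊗ₘ 𝟙 Y.dist) ⊗ₘ u) (Cleavage.map _ _ _)

/-- The cartesian arrow from a reindexing. -/
@[simps] def DRelCat.reindexMap (Y : DRelCat p) {I : B} (u : I ⟶ Y.pt) : Y.reindex u ⟶ Y where
  pt := u
  der := u ⊗ₘ 𝟙 Y.dist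
  rel := Cleavage.map (p := p) ((u ⊗ₘ 𝟙 Y.dist) ⊗ₘ u) Y.rel Y.obj_rel
  der_fst := tensorHom_fst _ _
  lifts := inferInstance

/-- Reindexing keeps the distances, so in a factorisation the arrow on `D` has its first projection
prescribed by `v` and its second by `f`. The relation then factors uniquely through the chosen
cartesian arrow. -/
theorem DRelCat.existsUnique_reindex (Y : DRelCat p) {I : B} (u : I ⟶ Y.pt) {Z : DRelCat p}
    (v : Z.pt ⟶ I) (f : Z ⟶ Y) (hf : f.pt = v ≫ u) :
    ∃! g : Z ⟶ Y.reindex u, g.pt = v ∧ g ≫ Y.reindexMap u = f := by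
  have hder : f.der = lift (fst Z.pt Z.dist ≫ v) (f.der ≫ snd _ _) ≫ (u ⊗ₘ 𝟙 Y.dist) := by
    apply CartesianMonoidalCategory.hom_ext <;> simp [hf]
  have hc : p.IsStronglyCartesian ((u ⊗ₘ 𝟙 Y.dist) ⊗ₘ u) (Y.reindexMap u).rel :=
    Cleavage.isCartesian _ _ _
  have hfac : f.der ⊗ₘ f.pt =
      (lift (fst Z.pt Z.dist ≫ v) (f.der ≫ snd _ _) ⊗ₘ v) ≫ ((u ⊗ₘ 𝟙 Y.dist) ⊗ₘ u) := by
    rw [tensorHom_comp_tensorHom, ← hder, hf]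
  have := f.lifts
  refine ⟨{ pt := v
            der := lift (fst Z.pt Z.dist ≫ v) (f.der ≫ snd _ _)
            rel := Functor.IsStronglyCartesian.map p ((u ⊗ₘ 𝟙 Y.dist) ⊗ₘ u) (Y.reindexMap u).rel
              hfac f.rel
            der_fst := lift_fst _ _
            lifts := inferInstance }, ⟨rfl, ?_⟩, ?_⟩
  · exact DRelCat.hom_ext hf.symm hder.symm (Functor.IsStronglyCartesian.fac p _ _ hfac f.rel)
  · rintro g ⟨hg₁, hg₂⟩
    have hg : g.der = lift (fst Z.pt Z.dist ≫ v) (f.der ≫ snd _ _) := by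
      apply CartesianMonoidalCategory.hom_ext
      · rw [g.der_fst, lift_fst, hg₁]
      · simp [← hg₂]
    have hl : p.IsHomLift (lift (fst Z.pt Z.dist ≫ v) (f.der ≫ snd _ _) ⊗ₘ v) g.rel := by
      rw [← hg, ← hg₁]; exact g.lifts
    exact DRelCat.hom_ext hg₁ hg
      (Functor.IsStronglyCartesian.map_uniq p _ _ hfac f.rel g.rel (congrArg Hom.rel hg₂))

/-- Replaces lifting conditions over `GDS p` by plain equations between arrows on points, free of
transports. -/
theorem isHomLift_GDS_iff {p : E ⥤ B} {X Y : DRelCat p} (u : X.pt ⟶ Y.pt) (f : X ⟶ Y) :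
    (GDS p).IsHomLift u f ↔ f.pt = u :=
  ⟨fun h => (@IsHomLift.eq_of_isHomLift _ _ _ _ (GDS p) X Y u f h).symm,
    fun h => h ▸ .map (p := GDS p) f⟩

theorem isStronglyCartesian_reindexMap (Y : DRelCat p) {I : B} (u : I ⟶ Y.pt) :
    (GDS p).IsStronglyCartesian u (Y.reindexMap u) where
  toIsHomLift := .map (p := GDS p) (Y.reindexMap u)
  universal_property' {Z} v f hf := by
    have h : f.pt = v ≫ u := (isHomLift_GDS_iff _ _).1 hf
    obtain ⟨g, ⟨hg₁, hg₂⟩, hg⟩ := Y.existsUnique_reindex u v f h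
    subst hg₁
    refine ⟨g, ⟨.map (p := GDS p) g, hg₂⟩, ?_⟩
    rintro k ⟨hk₁, hk₂⟩
    exact hg k ⟨(isHomLift_GDS_iff _ _).1 hk₁, hk₂⟩

/-- The differential relations in a fibration form a fibration. -/
@[reducible] def cleavageGDS : Cleavage (GDS p) where
  obj {I J} u Y h := Y.reindex (u ≫ eqToHom (show J = Y.pt from h.symm))
  map {I J} u Y h := Y.reindexMap (u ≫ eqToHom (show J = Y.pt from h.symm))
  isCartesian {I J} u Y h := by
    change Y.pt = J at h
    subst h
    -- After `subst` the reindexing arrow is `u` composed with an identity, equal to `u` only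
    -- propositionally; hence the generalisation to `w`.
    have key : ∀ w : I ⟶ Y.pt, w = u → (GDS p).IsStronglyCartesian u (Y.reindexMap w) := by
      rintro _ rfl
      exact isStronglyCartesian_reindexMap Y _
    exact key _ (Category.comp_id u)

end Fibration

/-! ### Components of the structural arrows of products of differential relations -/

section Products

variable {B : Type u₁} [Category.{v₁} B] [CartesianMonoidalCategory B]
variable {E : Type u₂} [Category.{v₂} E] [CartesianMonoidalCategory E]
variable {p : E ⥤ B} [Cleavage p] [StrictFiniteProducts p]

namespace DRelCat

variable (X Y Z : DRelCat p)

/-- The canonical arrow `DX × DY ⟶ D (X × Y)`. -/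
def derTensor : X.D ⊗ Y.D ⟶ (X ⊗ Y).D :=
  interchange X.pt X.dist Y.pt Y.dist

/-- The canonical arrow from the product of the relations of `X` and `Y` to the relation of
`X × Y`. -/
noncomputable def relTensor : X.rel ⊗ Y.rel ⟶ (X ⊗ Y).rel :=
  relProd X Y

theorem fst_der : (fst X Y).der = fst X.pt Y.pt ⊗ₘ fst X.dist Y.dist := rfl

theorem snd_der : (snd X Y).der = snd X.pt Y.pt ⊗ₘ snd X.dist Y.dist := rfl

theorem snd_pt : (snd X Y : X ⊗ Y ⟶ Y).pt = snd X.pt Y.pt := rfl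

@[simp] theorem interchange_interchange (I V J W : B) :
    interchange I V J W ≫ interchange I J V W = 𝟙 _ := by
  simp only [interchange]
  ext <;> simp

instance isIso_interchange (I V J W : B) : IsIso (interchange I V J W) :=
  ⟨interchange I J V W, interchange_interchange I V J W, interchange_interchange I J V W⟩

instance : IsIso (derTensor X Y) := isIso_interchange _ _ _ _

instance : IsIso (relTensor X Y) := isIso_relProd X Y

theorem isStronglyCocartesian_relTensor :
    p.IsStronglyCocartesian (unshuffle X.pt X.dist Y.pt Y.dist) (relTensor X Y) :=
  isStronglyCocartesian_relProd X Y

theorem derTensor_dist :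
    derTensor X Y ≫ snd (X ⊗ Y).pt (X ⊗ Y).dist = snd X.pt X.dist ⊗ₘ snd Y.pt Y.dist :=
  lift_snd _ _

-- This and the three companions below are the precise sense in which `D` and `rel` preserve binary
-- products: the comparison isomorphisms commute with the projections.
@[simp] theorem derTensor_fst : derTensor X Y ≫ (fst X Y).der = fst X.D Y.D := by
  rw [fst_der]
  simp only [derTensor, interchange]
  apply CartesianMonoidalCategory.hom_ext <;> simp

@[simp] theorem derTensor_snd : derTensor X Y ≫ (snd X Y).der = snd X.D Y.D := by
  rw [snd_der]
  simp only [derTensor, interchange]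
  apply CartesianMonoidalCategory.hom_ext <;> simp

@[simp] theorem relTensor_fst : relTensor X Y ≫ (fst X Y).rel = fst X.rel Y.rel := by
  have h := relProd_prodRel X Y =≫ fst X.rel Y.rel
  rwa [Category.assoc, Category.id_comp] at h

@[simp] theorem relTensor_snd : relTensor X Y ≫ (snd X Y).rel = snd X.rel Y.rel := by
  have h := relProd_prodRel X Y =≫ snd X.rel Y.rel
  rwa [Category.assoc, Category.id_comp] at h

variable {X Y Z}

/-- `D (X × Y)` is a product of `DX` and `DY`. -/
theorem tensor_der_hom_ext {K : B} {k l : K ⟶ (X ⊗ Y).D}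
    (h₁ : k ≫ (fst X Y).der = l ≫ (fst X Y).der)
    (h₂ : k ≫ (snd X Y).der = l ≫ (snd X Y).der) : k = l := by
  rw [← cancel_mono (inv (derTensor X Y))]
  apply CartesianMonoidalCategory.hom_ext
  · simpa [← derTensor_fst] using h₁
  · simpa [← derTensor_snd] using h₂

/-- The relation of `X × Y` is a product of the relations of `X` and `Y`. -/
theorem tensor_rel_hom_ext {K : E} {k l : K ⟶ (X ⊗ Y).rel}
    (h₁ : k ≫ (fst X Y).rel = l ≫ (fst X Y).rel)
    (h₂ : k ≫ (snd X Y).rel = l ≫ (snd X Y).rel) : k = l := by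
  rw [← cancel_mono (inv (relTensor X Y))]
  apply CartesianMonoidalCategory.hom_ext
  · simpa [← relTensor_fst] using h₁
  · simpa [← relTensor_snd] using h₂

section

variable {X' Y' : DRelCat p} (f : X ⟶ X') (g : Y ⟶ Y')

/-- As for the other structural arrows below, the components of a tensor product of arrows are
identified by comparing both projections. -/
theorem tensorHom_pt : (f ⊗ₘ g).pt = f.pt ⊗ₘ g.pt := by
  apply CartesianMonoidalCategory.hom_ext
  · exact (congrArg Hom.pt (tensorHom_fst f g)).trans (tensorHom_fst f.pt g.pt).symm
  · exact (congrArg Hom.pt (tensorHom_snd f g)).trans (tensorHom_snd f.pt g.pt).symm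

theorem derTensor_tensorHom :
    derTensor X Y ≫ (f ⊗ₘ g).der = (f.der ⊗ₘ g.der) ≫ derTensor X' Y' := by
  apply tensor_der_hom_ext
  · have h := congrArg Hom.der (tensorHom_fst f g)
    simp only [comp_der] at h
    rw [Category.assoc, h, Category.assoc, derTensor_fst, ← Category.assoc, derTensor_fst,
      tensorHom_fst]
  · have h := congrArg Hom.der (tensorHom_snd f g)
    simp only [comp_der] at h
    rw [Category.assoc, h, Category.assoc, derTensor_snd, ← Category.assoc, derTensor_snd,
      tensorHom_snd]

/-- Arrows in the image of a lifting act on distances independently of points. This property passes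
to products, as needed for the naturality of `zeta'`. -/
theorem tensorHom_der_snd {a : X.dist ⟶ X'.dist} {b : Y.dist ⟶ Y'.dist}
    (ha : f.der ≫ snd X'.pt X'.dist = snd X.pt X.dist ≫ a)
    (hb : g.der ≫ snd Y'.pt Y'.dist = snd Y.pt Y.dist ≫ b) :
    (f ⊗ₘ g).der ≫ snd (X' ⊗ Y').pt (X' ⊗ Y').dist =
      snd (X ⊗ Y).pt (X ⊗ Y).dist ≫ (a ⊗ₘ b) := by
  rw [← cancel_epi (derTensor X Y), comp_comp_of_sq (derTensor_tensorHom f g), derTensor_dist,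
    tensorHom_comp_tensorHom, ha, hb, comp_comp_of_eq (derTensor_dist X Y),
    tensorHom_comp_tensorHom]

theorem relTensor_tensorHom :
    relTensor X Y ≫ (f ⊗ₘ g).rel = (f.rel ⊗ₘ g.rel) ≫ relTensor X' Y' := by
  apply tensor_rel_hom_ext
  · have h := congrArg Hom.rel (tensorHom_fst f g)
    simp only [comp_rel] at h
    rw [Category.assoc, h, Category.assoc, relTensor_fst, ← Category.assoc, relTensor_fst,
      tensorHom_fst]
  · have h := congrArg Hom.rel (tensorHom_snd f g)
    simp only [comp_rel] at h
    rw [Category.assoc, h, Category.assoc, relTensor_snd, ← Category.assoc, relTensor_snd,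
      tensorHom_snd]

end

variable (X Y Z)

theorem associator_hom_pt : (α_ X Y Z).hom.pt = (α_ X.pt Y.pt Z.pt).hom := by
  have h₁ := congrArg Hom.pt (associator_hom_fst X Y Z)
  have h₂ := congrArg Hom.pt (associator_hom_snd_fst X Y Z)
  have h₃ := congrArg Hom.pt (associator_hom_snd_snd X Y Z)
  simp only [comp_pt, fst_pt, snd_pt] at h₁ h₂ h₃
  apply CartesianMonoidalCategory.hom_ext
  · exact h₁.trans (associator_hom_fst _ _ _).symm
  · apply CartesianMonoidalCategory.hom_ext
    · exact (Category.assoc _ _ _).trans (h₂.trans ((Category.assoc _ _ _).trans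
        (associator_hom_snd_fst X.pt Y.pt Z.pt)).symm)
    · exact (Category.assoc _ _ _).trans (h₃.trans ((Category.assoc _ _ _).trans
        (associator_hom_snd_snd X.pt Y.pt Z.pt)).symm)

theorem leftUnitor_hom_pt : (λ_ X).hom.pt = (λ_ X.pt).hom := by
  rw [leftUnitor_hom, leftUnitor_hom]; rfl

/-- `D` of the unit is `𝟙_ B ⊗ 𝟙_ B` rather than `𝟙_ B`, so a projection appears here in place of
the unitor of `B`. -/
theorem derTensor_leftUnitor : derTensor (𝟙_ (DRelCat p)) X ≫ (λ_ X).hom.der = snd _ _ := by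
  rw [leftUnitor_hom, derTensor_snd]

theorem relTensor_leftUnitor : relTensor (𝟙_ (DRelCat p)) X ≫ (λ_ X).hom.rel = snd _ _ := by
  rw [leftUnitor_hom, relTensor_snd]

/-- Both sides have the same three projections, to `X.D`, `Y.D` and `Z.D`. -/
theorem derTensor_associator :
    (derTensor X Y ▷ Z.D) ≫ derTensor (X ⊗ Y) Z ≫ (α_ X Y Z).hom.der =
      (α_ X.D Y.D Z.D).hom ≫ (X.D ◁ derTensor Y Z) ≫ derTensor X (Y ⊗ Z) := by
  have h₁ := congrArg Hom.der (associator_hom_fst X Y Z)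
  have h₂ := congrArg Hom.der (associator_hom_snd_fst X Y Z)
  have h₃ := congrArg Hom.der (associator_hom_snd_snd X Y Z)
  simp only [comp_der] at h₁ h₂ h₃
  have e₁ := derTensor_fst X Y
  have e₂ := derTensor_snd X Y
  have e₃ := derTensor_fst (X ⊗ Y) Z
  have e₄ := derTensor_snd (X ⊗ Y) Z
  have e₅ := derTensor_fst Y Z
  have e₆ := derTensor_snd Y Z
  have e₇ := derTensor_fst X (Y ⊗ Z)
  have e₈ := derTensor_snd X (Y ⊗ Z)
  apply tensor_der_hom_ext
  · simp only [Category.assoc, h₁, reassoc_of% e₃, e₇, whiskerRight_fst_assoc, e₁,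
      whiskerLeft_fst, associator_hom_fst]
  · apply tensor_der_hom_ext
    · simp only [Category.assoc, h₂, reassoc_of% e₃, reassoc_of% e₈, whiskerRight_fst_assoc, e₂,
        whiskerLeft_snd_assoc, e₅, associator_hom_snd_fst]
    · simp only [Category.assoc, h₃, e₄, reassoc_of% e₈, whiskerRight_snd,
        whiskerLeft_snd_assoc, e₆, associator_hom_snd_snd]

theorem relTensor_associator :
    (relTensor X Y ▷ Z.rel) ≫ relTensor (X ⊗ Y) Z ≫ (α_ X Y Z).hom.rel =
      (α_ X.rel Y.rel Z.rel).hom ≫ (X.rel ◁ relTensor Y Z) ≫ relTensor X (Y ⊗ Z) := by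
  have h₁ := congrArg Hom.rel (associator_hom_fst X Y Z)
  have h₂ := congrArg Hom.rel (associator_hom_snd_fst X Y Z)
  have h₃ := congrArg Hom.rel (associator_hom_snd_snd X Y Z)
  simp only [comp_rel] at h₁ h₂ h₃
  have e₁ := relTensor_fst X Y
  have e₂ := relTensor_snd X Y
  have e₃ := relTensor_fst (X ⊗ Y) Z
  have e₄ := relTensor_snd (X ⊗ Y) Z
  have e₅ := relTensor_fst Y Z
  have e₆ := relTensor_snd Y Z
  have e₇ := relTensor_fst X (Y ⊗ Z)
  have e₈ := relTensor_snd X (Y ⊗ Z)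
  apply tensor_rel_hom_ext
  · simp only [Category.assoc, h₁, reassoc_of% e₃, e₇, whiskerRight_fst_assoc, e₁,
      whiskerLeft_fst, associator_hom_fst]
  · apply tensor_rel_hom_ext
    · simp only [Category.assoc, h₂, reassoc_of% e₃, reassoc_of% e₈, whiskerRight_fst_assoc, e₂,
        whiskerLeft_snd_assoc, e₅, associator_hom_snd_fst]
    · simp only [Category.assoc, h₃, e₄, reassoc_of% e₈, whiskerRight_snd,
        whiskerLeft_snd_assoc, e₆, associator_hom_snd_snd]

/-- A product of cocartesian arrows, followed by the canonical arrow to the relation of the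
product, is cocartesian. -/
theorem isStronglyCocartesian_tensor_relTensor (hp : ProductPreservesCocartesian p)
    {X Y : DRelCat p} {I J : B} {V W : E} {v : I ⟶ X.nabla} {w : J ⟶ Y.nabla} {a : V ⟶ X.rel}
    {b : W ⟶ Y.rel} (ha : p.IsStronglyCocartesian v a) (hb : p.IsStronglyCocartesian w b) :
    p.IsStronglyCocartesian ((v ⊗ₘ w) ≫ unshuffle X.pt X.dist Y.pt Y.dist)
      ((a ⊗ₘ b) ≫ relTensor X Y) :=
  isStronglyCocartesian_comp (hp.tensor v w a b) (isStronglyCocartesian_relTensor X Y)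

end DRelCat

end Products

/-! ### Components of the lifted 2-arrows -/

section Components

variable {B : Type u₁} [Category.{v₁} B] [CartesianMonoidalCategory B]
variable {E : Type u₂} [Category.{v₂} E]
variable {C : Type u₃} [Category.{v₃} C] [CartesianMonoidalCategory C]
variable {D : Type u₄} [Category.{v₄} D]
variable {A : Type u₅} [Category.{v₅} A] [CartesianMonoidalCategory A]
variable {G : Type u₆} [Category.{v₆} G]
variable {p : E ⥤ B} {q : D ⥤ C} {r : G ⥤ A}

section

variable [Opcleavage q] {F F' : OneArrow p q}

/-- The distances of `F.hatObj X` are `F.b.obj X.D`, so on distances a lifted arrow is the image of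
the whole `f.der`. The formulas of this kind and those starting with `hatRel` replace the
definitions from here on. -/
theorem OneArrow.hat_map_der_snd (F : OneArrow p q) {X Y : DRelCat p} (f : X ⟶ Y) :
    (F.hat.map f).der ≫ snd (F.hatObj Y).pt (F.hatObj Y).dist =
      snd (F.hatObj X).pt (F.hatObj X).dist ≫ F.b.map f.der :=
  tensorHom_snd _ _

theorem OneArrow.hatRel_hat_map (F : OneArrow p q) {X Y : DRelCat p} (f : X ⟶ Y) :
    F.hatRel X ≫ (F.hat.map f).rel = F.t.map f.rel ≫ F.hatRel Y :=
  OneArrow.hatRel_hatHom _ _ _ _ _ (F.isHomLift _ _)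

theorem TwoArrow.hatApp_der_snd (φ : TwoArrow F F') (X : DRelCat p) :
    (φ.hatApp X).der ≫ snd (F'.hatObj X).pt (F'.hatObj X).dist =
      snd (F.hatObj X).pt (F.hatObj X).dist ≫ φ.b.app X.D :=
  tensorHom_snd _ _

theorem TwoArrow.hatRel_hatApp (φ : TwoArrow F F') (X : DRelCat p) :
    F.hatRel X ≫ (φ.hatApp X).rel = φ.t.app X.rel ≫ F'.hatRel X :=
  OneArrow.hatRel_hatHom _ _ _ _ _ _

/-- Tested on `F.hatRel X`, this is naturality of `φ.b` at `f.pt` and at `f.der`, and of `φ.t` at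
`f.rel`. -/
theorem TwoArrow.hatApp_naturality (φ : TwoArrow F F') {X Y : DRelCat p} (f : X ⟶ Y) :
    F.hat.map f ≫ φ.hatApp Y = φ.hatApp X ≫ F'.hat.map f := by
  refine hom_ext_of_isStronglyCocartesian (F.hatRel_cocartesian X) (φ.b.naturality f.pt) ?_ ?_
  · have h₁ := F.hat_map_der_snd f
    have h₂ := F'.hat_map_der_snd f
    have h₃ := φ.hatApp_der_snd X
    have h₄ := φ.hatApp_der_snd Y
    simp only [comp_der, Category.assoc]
    rw [h₄, comp_comp_of_sq h₁, h₂, comp_comp_of_sq h₃, φ.b.naturality]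
  · have h₁ := F.hatRel_hat_map f
    have h₂ := F'.hatRel_hat_map f
    have h₃ := φ.hatRel_hatApp X
    have h₄ := φ.hatRel_hatApp Y
    simp only [comp_rel]
    rw [comp_comp_of_sq h₁, h₄, comp_comp_of_sq h₃, h₂, φ.t.naturality_assoc]

end

section

variable [Opcleavage p]

/-- On relations this is the defining property of the lifted arrow; on distances it is the condition
`der_fst` on `f`. -/
theorem xi_naturality {X Y : DRelCat p} (f : X ⟶ Y) :
    f ≫ xi Y = xi X ≫ (OneArrow.id p).hat.map f := by
  refine DRelCat.hom_ext ?_ ?_ ?_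
  · exact (Category.comp_id f.pt).trans (Category.id_comp f.pt).symm
  · simp only [comp_der, xi, OneArrow.hatHom_der, lift_map, comp_lift, Functor.id_map,
      Category.comp_id, Category.id_comp, f.der_fst]
  · exact ((OneArrow.id p).hatRel_hat_map f).symm

theorem xi_der_snd (X : DRelCat p) :
    (xi X).der ≫ snd ((OneArrow.id p).hatObj X).pt ((OneArrow.id p).hatObj X).dist = 𝟙 X.D :=
  lift_snd _ _

end

section

variable [Opcleavage q] [Opcleavage r] (F : OneArrow p q) (K : OneArrow q r)
  (hK : K.IsCocartesian)

theorem omega_der_snd (X : DRelCat p) :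
    (omega F K hK X).der ≫ snd ((F.comp K).hatObj X).pt ((F.comp K).hatObj X).dist =
      snd (K.hatObj (F.hatObj X)).pt (K.hatObj (F.hatObj X)).dist ≫
        K.b.map (snd (F.hatObj X).pt (F.hatObj X).dist) :=
  tensorHom_snd _ _

theorem hatRel_omega (X : DRelCat p) :
    K.t.map (F.hatRel X) ≫ K.hatRel (F.hatObj X) ≫ (omega F K hK X).rel =
      (F.comp K).hatRel X := by
  rw [← Category.assoc]
  exact DRelCat.fac_desc _ _ _ _ _ _ _ _ _ _

/-- The relation of an iterated lifting is the codomain of a cocartesian arrow. -/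
theorem isStronglyCocartesian_hatRel_hatRel (hK : K.IsCocartesian) (X : DRelCat p) :
    r.IsStronglyCocartesian
      (K.b.map (splitArrow F.b X.pt X.dist) ≫ splitArrow K.b (F.hatObj X).pt (F.hatObj X).dist)
      (K.t.map (F.hatRel X) ≫ K.hatRel (F.hatObj X)) :=
  isStronglyCocartesian_comp (hK.map (splitArrow F.b X.pt X.dist) (F.hatRel X))
    (K.hatRel_cocartesian (F.hatObj X))

end

end Components

/-! ### The comparison isomorphisms and the components of the lifted strength -/

section Strength

variable {B : Type u₁} [Category.{v₁} B] [CartesianMonoidalCategory B]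
variable {E : Type u₂} [Category.{v₂} E] [CartesianMonoidalCategory E]
variable {p : E ⥤ B} [StrictFiniteProducts p] [Cleavage p] [Opcleavage p]

section Zeta

variable (T : OneArrow p p)

theorem zeta_der_snd (X Y : DRelCat p) :
    (zeta T X Y).der ≫ snd (T.hatObj (X ⊗ Y)).pt (T.hatObj (X ⊗ Y)).dist =
      snd ((strengthCod T).hatObj (X.pair Y)).pt ((strengthCod T).hatObj (X.pair Y)).dist ≫
        T.b.map (derTensor X Y) :=
  tensorHom_snd _ _

theorem hatRel_zeta (X Y : DRelCat p) :
    (strengthCod T).hatRel (X.pair Y) ≫ (zeta T X Y).rel =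
      T.t.map (relTensor X Y) ≫ T.hatRel (X ⊗ Y) :=
  DRelCat.fac_desc _ _ _ _ _ _ _ _ _ _

/-- `relProd` is invertible, so its image under `T.t` is cocartesian, and so is the composite with
`T.hatRel (X ⊗ Y)` that induces `zeta`. On distances `interchange` is invertible. -/
theorem isIso_zeta (X Y : DRelCat p) : IsIso (zeta T X Y) := by
  have := isHomLift_relProd X Y
  have := T.isHomLift (unshuffle X.pt X.dist Y.pt Y.dist) (relProd X Y)
  have h' : IsIso (unshuffle X.pt X.dist Y.pt Y.dist) :=
    ⟨shuffle X.pt X.dist Y.pt Y.dist, unshuffle_shuffle _ _ _ _, shuffle_unshuffle _ _ _ _⟩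
  refine DRelCat.isIso_desc _ _ _ _ _ _ _ _ _ _ (hu := IsIso.id _) (hd' := ?_) ?_
  · have : IsIso (T.b.map (interchange X.pt X.dist Y.pt Y.dist)) := inferInstance
    exact @MonoidalCategory.tensor_isIso _ _ _ _ _ _ _ _ (IsIso.id _) _ this
  · exact isStronglyCocartesian_comp (Functor.IsStronglyCocartesian.of_isIso p _ _)
      (T.hatRel_cocartesian (X ⊗ Y))

/-- The content is the naturality of `derTensor` and `relTensor`, transported along `T.b` and `T.t`.
-/
theorem zeta_naturality {X X' Y Y' : DRelCat p} (f : X ⟶ X') (g : Y ⟶ Y') :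
    (strengthCod T).hat.map (DRelCat.pairMap f g) ≫ zeta T X' Y' =
      zeta T X Y ≫ T.hat.map (f ⊗ₘ g) := by
  refine hom_ext_of_isStronglyCocartesian ((strengthCod T).hatRel_cocartesian (X.pair Y)) ?_ ?_ ?_
  · refine (Category.comp_id _).trans (Eq.trans ?_ (Category.id_comp _).symm)
    exact congrArg T.b.map (tensorHom_pt f g).symm
  · have h₁ := (strengthCod T).hat_map_der_snd (DRelCat.pairMap f g)
    have h₂ := T.hat_map_der_snd (f ⊗ₘ g)
    have h₃ := zeta_der_snd T X Y
    have h₄ := zeta_der_snd T X' Y'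
    simp only [comp_der, Category.assoc]
    rw [h₄, comp_comp_of_sq h₁, h₂, comp_comp_of_sq h₃, ← Functor.map_comp, derTensor_tensorHom,
      Functor.map_comp]
    rfl
  · have h₁ := (strengthCod T).hatRel_hat_map (DRelCat.pairMap f g)
    have h₂ := T.hatRel_hat_map (f ⊗ₘ g)
    have h₃ := hatRel_zeta T X Y
    have h₄ := hatRel_zeta T X' Y'
    simp only [comp_rel]
    rw [comp_comp_of_sq h₁, h₄, comp_comp_of_sq h₃, h₂, ← Functor.map_comp_assoc, relTensor_tensorHom,
      Functor.map_comp_assoc]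
    rfl

end Zeta

section Zeta'

variable (hp : ProductPreservesCocartesian p) (T : OneArrow p p)

theorem hatRel_zeta' (X Y : DRelCat p) :
    ((OneArrow.id p).hatRel X ⊗ₘ T.hatRel Y) ≫
        relTensor ((OneArrow.id p).hatObj X) (T.hatObj Y) ≫ (zeta' hp T X Y).rel =
      (strengthDom T).hatRel (X.pair Y) := by
  rw [← Category.assoc]
  exact DRelCat.fac_desc _ _ _ _ _ _ _ _ _ _

/-- The arrow that induces `zeta'` is a chosen cocartesian arrow, and the other two components are
identities. -/
theorem isIso_zeta' (X Y : DRelCat p) : IsIso (zeta' hp T X Y) :=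
  DRelCat.isIso_desc _ _ _ _ _ _ _ _ _ _ (hu := IsIso.id _) (hd' := IsIso.id _)
    ((strengthDom T).hatRel_cocartesian (X.pair Y))

theorem zeta'_naturality {X X' Y Y' : DRelCat p} (f : X ⟶ X') (g : Y ⟶ Y') :
    ((OneArrow.id p).hat.map f ⊗ₘ T.hat.map g) ≫ zeta' hp T X' Y' =
      zeta' hp T X Y ≫ (strengthDom T).hat.map (DRelCat.pairMap f g) := by
  refine hom_ext_of_isStronglyCocartesian (isStronglyCocartesian_tensor_relTensor
    (X := (OneArrow.id p).hatObj X) (Y := T.hatObj Y) hp ((OneArrow.id p).hatRel_cocartesian X)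
    (T.hatRel_cocartesian Y)) ?_ ?_ ?_
  · refine (Category.comp_id _).trans (Eq.trans ?_ (Category.id_comp _).symm)
    exact tensorHom_pt _ _
  · have h₀ := tensorHom_der_snd ((OneArrow.id p).hat.map f) (T.hat.map g)
      ((OneArrow.id p).hat_map_der_snd f) (T.hat_map_der_snd g)
    have h₃ := (strengthDom T).hat_map_der_snd (DRelCat.pairMap f g)
    simp only [comp_der, Category.assoc]
    -- `zeta'` is the identity on distances, so the two liftings are compared directly.
    exact (congrArg _ (Category.id_comp _)).trans (h₀.trans ((Category.id_comp _).trans h₃).symm)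
  · have h₀ := relTensor_tensorHom ((OneArrow.id p).hat.map f) (T.hat.map g)
    have h₁ := (OneArrow.id p).hatRel_hat_map f
    have h₂ := T.hatRel_hat_map g
    have h₃ := (strengthDom T).hatRel_hat_map (DRelCat.pairMap f g)
    have h₄ := hatRel_zeta' hp T X Y
    have h₅ := hatRel_zeta' hp T X' Y'
    simp only [comp_rel, Category.assoc]
    rw [comp_comp_of_sq h₀, tensorHom_comp_tensorHom_assoc, h₁, h₂, comp_comp_comp_of_eq h₄, h₃, ← h₅,
      ← tensorHom_comp_tensorHom_assoc]
    rfl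

end Zeta'

section LiftedStrength

variable (hp : ProductPreservesCocartesian p) (T : OneArrow p p)
  (st : TwoArrow (strengthDom T) (strengthCod T))

theorem liftedStrength_naturality {X X' Y Y' : DRelCat p} (f : X ⟶ X') (g : Y ⟶ Y') :
    (f ⊗ₘ T.hat.map g) ≫ liftedStrength hp T st X' Y' =
      liftedStrength hp T st X Y ≫ T.hat.map (f ⊗ₘ g) := by
  have h : (f ⊗ₘ T.hat.map g) ≫ (xi X' ▷ T.hatObj Y') =
      (xi X ▷ T.hatObj Y) ≫ ((OneArrow.id p).hat.map f ⊗ₘ T.hat.map g) := by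
    rw [← tensorHom_id, ← tensorHom_id, tensorHom_comp_tensorHom, tensorHom_comp_tensorHom,
      xi_naturality, Category.id_comp, Category.comp_id]
  have h₁ := zeta'_naturality hp T f g
  have h₂ := st.hatApp_naturality (DRelCat.pairMap f g)
  have h₃ := zeta_naturality T f g
  simp only [liftedStrength, Category.assoc]
  rw [comp_comp_of_sq h, comp_comp_of_sq h₁, comp_comp_of_sq h₂, h₃]

theorem liftedStrength_pt (X Y : DRelCat p) :
    (liftedStrength hp T st X Y).pt = strengthApp st.b X.pt Y.pt := by
  have h : (xi X ▷ T.hatObj Y).pt = 𝟙 (X.pt ⊗ T.b.obj Y.pt) := by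
    rw [← tensorHom_id, tensorHom_pt]
    exact id_tensorHom_id _ _
  simp only [liftedStrength, comp_pt, h]
  refine (Category.id_comp _).trans ((Category.id_comp _).trans (Category.comp_id _))

/-- `xi X` provides `X.D` as the distances of its codomain, and those of `T.hatObj Y` are `T.b.obj
Y.D`; the strength of `T.b` is therefore taken at `X.D` and `Y.D`. -/
theorem derTensor_liftedStrength (X Y : DRelCat p) :
    derTensor X (T.hatObj Y) ≫ (liftedStrength hp T st X Y).der ≫
        snd (T.hatObj (X ⊗ Y)).pt (T.hatObj (X ⊗ Y)).dist =
      (X.D ◁ snd (T.hatObj Y).pt (T.hatObj Y).dist) ≫ strengthApp st.b X.D Y.D ≫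
        T.b.map (derTensor X Y) := by
  have h₀ := derTensor_tensorHom (xi X) (𝟙 (T.hatObj Y))
  have h₁ := zeta_der_snd T X Y
  have h₂ := st.hatApp_der_snd (X.pair Y)
  have h₃ := derTensor_dist ((OneArrow.id p).hatObj X) (T.hatObj Y)
  have e : (zeta' hp T X Y).der = 𝟙 ((OneArrow.id p).hatObj X ⊗ T.hatObj Y).D := rfl
  have h₄ := xi_der_snd X
  simp only [liftedStrength, comp_der, Category.assoc, ← tensorHom_id]
  rw [h₁, comp_comp_of_sq h₂, comp_comp_of_sq h₀, e]
  -- The intermediate composite is written out because the projections of the two lifted objects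
  -- agree with it only by unfolding definitions.
  refine Eq.trans (b := ((xi X).der ⊗ₘ (𝟙 (T.hatObj Y) : T.hatObj Y ⟶ _).der) ≫
    (snd _ _ ⊗ₘ snd _ _) ≫ strengthApp st.b X.D Y.D ≫ T.b.map (derTensor X Y)) ?_ ?_
  · rw [Category.id_comp, ← h₃, Category.assoc]
    rfl
  · rw [tensorHom_comp_tensorHom_assoc, h₄, id_der, Category.id_comp, id_tensorHom]

theorem relTensor_liftedStrength (X Y : DRelCat p) :
    (X.rel ◁ T.hatRel Y) ≫ relTensor X (T.hatObj Y) ≫ (liftedStrength hp T st X Y).rel =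
      strengthApp st.t X.rel Y.rel ≫ T.t.map (relTensor X Y) ≫ T.hatRel (X ⊗ Y) := by
  have h₀ := relTensor_tensorHom (xi X) (𝟙 (T.hatObj Y))
  have h₁ := hatRel_zeta T X Y
  have h₂ := st.hatRel_hatApp (X.pair Y)
  have h₃ := hatRel_zeta' hp T X Y
  -- This produces exactly the product of cocartesian arrows that occurs in the defining equation of
  -- `zeta'`.
  have e : (xi X).rel = (OneArrow.id p).hatRel X := rfl
  simp only [liftedStrength, comp_rel, ← tensorHom_id, ← id_tensorHom]
  rw [comp_comp_of_sq h₀, e, id_rel, tensorHom_comp_tensorHom_assoc, Category.comp_id,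
    Category.id_comp, comp_comp_comp_of_eq h₃, comp_comp_of_sq h₂, h₁]
  rfl

end LiftedStrength

end Strength

/-! ### The lifted strong monad -/

section LiftedMonad

variable {B : Type u₁} [Category.{v₁} B] [CartesianMonoidalCategory B]
variable {E : Type u₂} [Category.{v₂} E]
variable {p : E ⥤ B} [Opcleavage p] {T : OneArrow p p}

/-- The lifted unit. -/
noncomputable def liftedUnit (η : TwoArrow (OneArrow.id p) T) (X : DRelCat p) : X ⟶ T.hatObj X :=
  xi X ≫ η.hatApp X

/-- The lifted multiplication. -/
noncomputable def liftedMul (hT : T.IsCocartesian) (μ : TwoArrow (T.comp T) T) (X : DRelCat p) :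
    T.hatObj (T.hatObj X) ⟶ T.hatObj X :=
  omega T T hT X ≫ μ.hatApp X

section Unit

variable (η : TwoArrow (OneArrow.id p) T)

theorem liftedUnit_pt (X : DRelCat p) : (liftedUnit η X).pt = η.b.app X.pt :=
  Category.id_comp _

theorem liftedUnit_der_snd (X : DRelCat p) :
    (liftedUnit η X).der ≫ snd (T.hatObj X).pt (T.hatObj X).dist = η.b.app X.D := by
  simp only [liftedUnit, comp_der, Category.assoc]
  rw [η.hatApp_der_snd, comp_comp_of_eq (xi_der_snd X)]
  exact Category.id_comp _

/-- No test arrow is needed: `(xi X).rel` is itself the cocartesian arrow on which the lifting of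
`η` is defined. -/
theorem liftedUnit_rel (X : DRelCat p) :
    (liftedUnit η X).rel = η.t.app X.rel ≫ T.hatRel X :=
  η.hatRel_hatApp X

theorem liftedUnit_naturality {X Y : DRelCat p} (f : X ⟶ Y) :
    f ≫ liftedUnit η Y = liftedUnit η X ≫ T.hat.map f := by
  have h₁ := xi_naturality f
  have h₂ := η.hatApp_naturality f
  simp only [liftedUnit, Category.assoc]
  rw [← h₂, comp_comp_of_sq h₁]

end Unit

section Mul

variable (hT : T.IsCocartesian) (μ : TwoArrow (T.comp T) T)

theorem liftedMul_pt (X : DRelCat p) : (liftedMul hT μ X).pt = μ.b.app X.pt :=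
  Category.id_comp _

/-- The distances of the double lifting are `T.b` of the product of `T.b.obj X.pt` and `T.b.obj
X.D`; the superfluous first factor is projected away before multiplying. -/
theorem liftedMul_der_snd (X : DRelCat p) :
    (liftedMul hT μ X).der ≫ snd (T.hatObj X).pt (T.hatObj X).dist =
      snd (T.hatObj (T.hatObj X)).pt (T.hatObj (T.hatObj X)).dist ≫
        T.b.map (snd (T.hatObj X).pt (T.hatObj X).dist) ≫ μ.b.app X.D := by
  simp only [liftedMul, comp_der, Category.assoc]
  rw [μ.hatApp_der_snd, comp_comp_of_sq (omega_der_snd T T hT X)]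

theorem hatRel_liftedMul (X : DRelCat p) :
    T.t.map (T.hatRel X) ≫ T.hatRel (T.hatObj X) ≫ (liftedMul hT μ X).rel =
      μ.t.app X.rel ≫ T.hatRel X := by
  simp only [liftedMul, comp_rel]
  rw [comp_comp_comp_of_eq (hatRel_omega T T hT X), μ.hatRel_hatApp]

theorem liftedMul_naturality {X Y : DRelCat p} (f : X ⟶ Y) :
    T.hat.map (T.hat.map f) ≫ liftedMul hT μ Y = liftedMul hT μ X ≫ T.hat.map f := by
  refine hom_ext_of_isStronglyCocartesian (isStronglyCocartesian_hatRel_hatRel T T hT X) ?_ ?_ ?_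
  · simp only [comp_pt, liftedMul_pt]
    exact μ.b.naturality f.pt
  · simp only [comp_der, Category.assoc]
    rw [liftedMul_der_snd, comp_comp_of_sq (T.hat_map_der_snd (T.hat.map f)),
      ← Functor.map_comp_assoc, T.hat_map_der_snd,
      comp_comp_of_sq (liftedMul_der_snd hT μ X), Functor.map_comp_assoc, Category.assoc]
    exact congrArg (_ ≫ _ ≫ ·) (μ.b.naturality f.der)
  · simp only [comp_rel, Category.assoc]
    rw [comp_comp_of_sq (T.hatRel_hat_map (T.hat.map f)), ← Functor.map_comp_assoc,
      T.hatRel_hat_map, Functor.map_comp_assoc, hatRel_liftedMul,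
      comp_comp_comp_of_eq (hatRel_liftedMul hT μ X), Category.assoc, T.hatRel_hat_map]
    exact comp_comp_of_sq (μ.t.naturality f.rel) _

end Mul

/-! ### The monad laws of the lifting -/

section MonadLaws

variable (η : TwoArrow (OneArrow.id p) T) (hT : T.IsCocartesian) (μ : TwoArrow (T.comp T) T)

theorem liftedUnit_liftedMul (hb : ∀ I, η.b.app (T.b.obj I) ≫ μ.b.app I = 𝟙 (T.b.obj I))
    (ht : ∀ V, η.t.app (T.t.obj V) ≫ μ.t.app V = 𝟙 (T.t.obj V)) (X : DRelCat p) :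
    liftedUnit η (T.hatObj X) ≫ liftedMul hT μ X = 𝟙 (T.hatObj X) := by
  refine hom_ext_of_isStronglyCocartesian (T.hatRel_cocartesian X) ?_ ?_ ?_
  · simp only [comp_pt, liftedUnit_pt, liftedMul_pt]
    exact hb X.pt
  · simp only [comp_der, Category.assoc]
    rw [liftedMul_der_snd, comp_comp_of_eq (liftedUnit_der_snd η (T.hatObj X))]
    -- Naturality at the projection to `T.b.obj X.D` brings the unit law to `X.D`.
    refine (comp_comp_of_sq (η.b.naturality (snd (T.hatObj X).pt (T.hatObj X).dist)).symm _).trans ?_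
    refine (congrArg (_ ≫ ·) (hb X.D)).trans ?_
    exact (Category.comp_id _).trans (Category.id_comp _).symm
  · simp only [comp_rel, liftedUnit_rel, Category.assoc]
    refine (comp_comp_of_sq (η.t.naturality (T.hatRel X)) _).trans ?_
    refine (congrArg (_ ≫ ·) (hatRel_liftedMul hT μ X)).trans ?_
    refine (comp_comp_of_eq (ht X.rel) _).trans ?_
    exact (Category.id_comp _).trans (Category.comp_id _).symm

theorem map_liftedUnit_liftedMul (hb : ∀ I, T.b.map (η.b.app I) ≫ μ.b.app I = 𝟙 (T.b.obj I))
    (ht : ∀ V, T.t.map (η.t.app V) ≫ μ.t.app V = 𝟙 (T.t.obj V)) (X : DRelCat p) :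
    T.hat.map (liftedUnit η X) ≫ liftedMul hT μ X = 𝟙 (T.hatObj X) := by
  refine hom_ext_of_isStronglyCocartesian (T.hatRel_cocartesian X) ?_ ?_ ?_
  · refine (congrArg₂ (· ≫ ·) (congrArg T.b.map (liftedUnit_pt η X)) (liftedMul_pt hT μ X)).trans ?_
    exact hb X.pt
  · simp only [comp_der, Category.assoc]
    rw [liftedMul_der_snd, comp_comp_of_sq (T.hat_map_der_snd (liftedUnit η X)),
      ← Functor.map_comp_assoc, liftedUnit_der_snd]
    refine (congrArg (_ ≫ ·) (hb X.D)).trans ?_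
    exact (Category.comp_id _).trans (Category.id_comp _).symm
  · simp only [comp_rel]
    rw [comp_comp_of_sq (T.hatRel_hat_map (liftedUnit η X)), liftedUnit_rel,
      Functor.map_comp_assoc, hatRel_liftedMul]
    refine (comp_comp_of_eq (ht X.rel) _).trans ?_
    exact (Category.id_comp _).trans (Category.comp_id _).symm

theorem liftedMul_assoc
    (hb : ∀ I, T.b.map (μ.b.app I) ≫ μ.b.app I = μ.b.app (T.b.obj I) ≫ μ.b.app I)
    (ht : ∀ V, T.t.map (μ.t.app V) ≫ μ.t.app V = μ.t.app (T.t.obj V) ≫ μ.t.app V)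
    (X : DRelCat p) :
    T.hat.map (liftedMul hT μ X) ≫ liftedMul hT μ X =
      liftedMul hT μ (T.hatObj X) ≫ liftedMul hT μ X := by
  -- The test arrow into the relation of the triple lifting: `T` applied to the one for the double
  -- lifting, then one more `hatRel`.
  have hc := isStronglyCocartesian_comp
    (hT.map _ _ (hf := isStronglyCocartesian_hatRel_hatRel T T hT X))
    (T.hatRel_cocartesian (T.hatObj (T.hatObj X)))
  refine hom_ext_of_isStronglyCocartesian hc ?_ ?_ ?_
  · refine (congrArg₂ (· ≫ ·) (congrArg T.b.map (liftedMul_pt hT μ X))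
      (liftedMul_pt hT μ X)).trans ?_
    rw [comp_pt, liftedMul_pt, liftedMul_pt]
    exact hb X.pt
  · simp only [comp_der, Category.assoc]
    rw [liftedMul_der_snd, comp_comp_of_sq (T.hat_map_der_snd (liftedMul hT μ X)),
      ← Functor.map_comp_assoc, liftedMul_der_snd, Functor.map_comp_assoc, Functor.map_comp_assoc,
      hb, comp_comp_of_sq (liftedMul_der_snd hT μ (T.hatObj X)), Category.assoc]
    refine congrArg (_ ≫ _ ≫ ·) ?_
    exact comp_comp_of_sq (μ.b.naturality (snd (T.hatObj X).pt (T.hatObj X).dist)) _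
  · simp only [comp_rel, Category.assoc]
    rw [comp_comp_of_sq (T.hatRel_hat_map (liftedMul hT μ X)), ← Functor.map_comp_assoc,
      Category.assoc, hatRel_liftedMul, Functor.map_comp_assoc, hatRel_liftedMul,
      comp_comp_of_eq (ht X.rel), Functor.map_comp_assoc,
      comp_comp_comp_of_eq (hatRel_liftedMul hT μ (T.hatObj X)), Category.assoc, Category.assoc]
    refine Eq.trans ?_ (comp_comp_of_sq (μ.t.naturality (T.hatRel X)) _).symm
    rw [hatRel_liftedMul]

end MonadLaws

end LiftedMonad

/-! ### Naturality of a strength and its unit law -/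

section StrengthApp

variable {C : Type u₁} [Category.{v₁} C] [CartesianMonoidalCategory C] {T : C ⥤ C}
  (st : (𝟭 C).prod T ⋙ tensor C ⟶ tensor C ⋙ T)

theorem strengthApp_naturality {X X' Y Y' : C} (f : X ⟶ X') (g : Y ⟶ Y') :
    (f ⊗ₘ T.map g) ≫ strengthApp st X' Y' = strengthApp st X Y ≫ T.map (f ⊗ₘ g) :=
  st.naturality (X := (X, Y)) (Y := (X', Y')) (Prod.mkHom f g)

theorem strengthApp_naturality_left {X X' : C} (f : X ⟶ X') (Y : C) :
    (f ▷ T.obj Y) ≫ strengthApp st X' Y = strengthApp st X Y ≫ T.map (f ▷ Y) := by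
  simpa using strengthApp_naturality st f (𝟙 Y)

theorem strengthApp_naturality_right (X : C) {Y Y' : C} (g : Y ⟶ Y') :
    (X ◁ T.map g) ≫ strengthApp st X Y' = strengthApp st X Y ≫ T.map (X ◁ g) := by
  simpa using strengthApp_naturality st (𝟙 X) g

/-- The unit law of a strength at an arbitrary object in the first argument. -/
theorem strengthApp_snd
    (h : ∀ X, strengthApp st (𝟙_ C) X ≫ T.map (λ_ X).hom = (λ_ (T.obj X)).hom) (X Y : C) :
    strengthApp st X Y ≫ T.map (snd X Y) = snd X (T.obj Y) := by
  -- The projection factors through `𝟙_ C ⊗ Z`, so naturality in the first argument reduces the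
  -- claim to the unit law.
  have e : ∀ Z : C, snd X Z = (toUnit X ▷ Z) ≫ (λ_ Z).hom := fun Z => by simp [leftUnitor_hom]
  rw [e, e, Functor.map_comp, ← comp_comp_of_sq (strengthApp_naturality_left st (toUnit X) Y), h]

end StrengthApp

/-! ### Whiskering of differential relations -/

section Products

variable {B : Type u₁} [Category.{v₁} B] [CartesianMonoidalCategory B]
variable {E : Type u₂} [Category.{v₂} E] [CartesianMonoidalCategory E]
variable {p : E ⥤ B} [StrictFiniteProducts p] [Cleavage p]

namespace DRelCat

variable (X : DRelCat p) {Y Y' : DRelCat p} (g : Y ⟶ Y')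

theorem whiskerLeft_pt : (X ◁ g).pt = X.pt ◁ g.pt := by
  rw [← id_tensorHom, tensorHom_pt, ← id_tensorHom]
  rfl

theorem derTensor_whiskerLeft :
    derTensor X Y ≫ (X ◁ g).der = (X.D ◁ g.der) ≫ derTensor X Y' := by
  rw [← id_tensorHom, derTensor_tensorHom, ← id_tensorHom]
  rfl

theorem relTensor_whiskerLeft :
    relTensor X Y ≫ (X ◁ g).rel = (X.rel ◁ g.rel) ≫ relTensor X Y' := by
  rw [← id_tensorHom, relTensor_tensorHom, ← id_tensorHom]
  rfl

theorem isStronglyCocartesian_whiskerLeft_relTensor (hp : ProductPreservesCocartesian p)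
    {I : B} {W : E} {w : I ⟶ Y.nabla} {b : W ⟶ Y.rel} (hb : p.IsStronglyCocartesian w b) :
    p.IsStronglyCocartesian ((𝟙 X.nabla ⊗ₘ w) ≫ unshuffle X.pt X.dist Y.pt Y.dist)
      ((X.rel ◁ b) ≫ relTensor X Y) := by
  have := X.isHomLift_id
  rw [← id_tensorHom]
  exact isStronglyCocartesian_tensor_relTensor hp (Functor.IsStronglyCocartesian.of_isIso p _ _) hb

end DRelCat

end Products

/-! ### The strength laws of the lifting -/

section StrengthLaws

variable {B : Type u₁} [Category.{v₁} B] [CartesianMonoidalCategory B]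
variable {E : Type u₂} [Category.{v₂} E] [CartesianMonoidalCategory E]
variable {p : E ⥤ B} [StrictFiniteProducts p] [Cleavage p] [Opcleavage p]
variable (hp : ProductPreservesCocartesian p) {T : OneArrow p p}
  (st : TwoArrow (strengthDom T) (strengthCod T))

/-- The unit differential relation does not have the unit objects as its `D` and `rel`, so distances
and relations need the unit law in the form `strengthApp_snd`. -/
theorem liftedStrength_leftUnitor
    (hb : ∀ I, strengthApp st.b (𝟙_ B) I ≫ T.b.map (λ_ I).hom = (λ_ (T.b.obj I)).hom)
    (ht : ∀ V, strengthApp st.t (𝟙_ E) V ≫ T.t.map (λ_ V).hom = (λ_ (T.t.obj V)).hom)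
    (X : DRelCat p) :
    liftedStrength hp T st (𝟙_ _) X ≫ T.hat.map (λ_ X).hom = (λ_ (T.hatObj X)).hom := by
  refine hom_ext_of_isStronglyCocartesian (isStronglyCocartesian_whiskerLeft_relTensor
    (𝟙_ (DRelCat p)) (Y := T.hatObj X) hp (T.hatRel_cocartesian X)) ?_ ?_ ?_
  · refine (congrArg₂ (· ≫ ·) (liftedStrength_pt hp T st _ _)
      (congrArg T.b.map (leftUnitor_hom_pt X))).trans ?_
    exact (hb X.pt).trans (leftUnitor_hom_pt (T.hatObj X)).symm
  · simp only [comp_der, Category.assoc]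
    rw [← cancel_epi (derTensor (𝟙_ (DRelCat p)) (T.hatObj X)), T.hat_map_der_snd,
      comp_comp_comp_of_eq (derTensor_liftedStrength hp T st _ _), Category.assoc, Category.assoc,
      ← Functor.map_comp, derTensor_leftUnitor, strengthApp_snd st.b hb,
      comp_comp_of_eq (derTensor_leftUnitor _), whiskerLeft_snd]
  · simp only [comp_rel, Category.assoc]
    rw [comp_comp_comp_of_eq (relTensor_liftedStrength hp T st _ _), Category.assoc,
      Category.assoc, T.hatRel_hat_map, ← Functor.map_comp_assoc, relTensor_leftUnitor,
      comp_comp_of_eq (strengthApp_snd st.t ht _ _), relTensor_leftUnitor, whiskerLeft_snd]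

theorem liftedStrength_associator
    (hb : ∀ I J K, strengthApp st.b (I ⊗ J) K ≫ T.b.map (α_ I J K).hom =
      (α_ I J (T.b.obj K)).hom ≫ (I ◁ strengthApp st.b J K) ≫ strengthApp st.b I (J ⊗ K))
    (ht : ∀ U V W, strengthApp st.t (U ⊗ V) W ≫ T.t.map (α_ U V W).hom =
      (α_ U V (T.t.obj W)).hom ≫ (U ◁ strengthApp st.t V W) ≫ strengthApp st.t U (V ⊗ W))
    (X Y Z : DRelCat p) :
    liftedStrength hp T st (X ⊗ Y) Z ≫ T.hat.map (α_ X Y Z).hom =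
      (α_ X Y (T.hatObj Z)).hom ≫ (X ◁ liftedStrength hp T st Y Z) ≫
        liftedStrength hp T st X (Y ⊗ Z) := by
  -- The test arrow starts at `(X.rel ⊗ Y.rel) ⊗ T.t.obj Z.rel`, where the associativity law of
  -- `T.t` applies.
  refine hom_ext_of_isStronglyCocartesian (isStronglyCocartesian_tensor_relTensor hp
    (X := X ⊗ Y) (Y := T.hatObj Z) (isStronglyCocartesian_relTensor X Y)
    (T.hatRel_cocartesian Z)) ?_ ?_ ?_
  · refine (congrArg₂ (· ≫ ·) (liftedStrength_pt hp T st (X ⊗ Y) Z)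
      (congrArg T.b.map (associator_hom_pt X Y Z))).trans ((hb X.pt Y.pt Z.pt).trans ?_)
    simp only [comp_pt, associator_hom_pt, whiskerLeft_pt, liftedStrength_pt]
    rfl
  · simp only [comp_der, Category.assoc]
    -- Cancelling two comparison isomorphisms moves the equation to `(X.D ⊗ Y.D) ⊗ (T.hatObj Z).D`.
    rw [← cancel_epi (derTensor (X ⊗ Y) (T.hatObj Z)),
      ← cancel_epi (derTensor X Y ▷ (T.hatObj Z).D), T.hat_map_der_snd,
      comp_comp_comp_of_eq (derTensor_liftedStrength hp T st (X ⊗ Y) Z), Category.assoc,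
      Category.assoc, ← whisker_exchange_assoc,
      comp_comp_of_sq (strengthApp_naturality_left st.b (derTensor X Y) Z.D),
      ← Functor.map_comp, ← Functor.map_comp, derTensor_associator, Functor.map_comp,
      comp_comp_of_eq (hb X.D Y.D Z.D), comp_comp_comp_of_eq (derTensor_associator X Y (T.hatObj Z))]
    simp only [Category.assoc]
    rw [comp_comp_of_sq (derTensor_whiskerLeft X (liftedStrength hp T st Y Z)),
      derTensor_liftedStrength, ← whiskerLeft_comp_assoc, ← whiskerLeft_comp_assoc, Category.assoc,
      derTensor_liftedStrength, whiskerLeft_comp_assoc, whiskerLeft_comp_assoc,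
      comp_comp_of_sq (strengthApp_naturality_right st.b X.D (derTensor Y Z)), Functor.map_comp,
      associator_naturality_right_assoc]
  · simp only [comp_rel, Category.assoc]
    rw [tensorHom_def_assoc, comp_comp_comp_of_eq (relTensor_liftedStrength hp T st (X ⊗ Y) Z),
      Category.assoc, Category.assoc, T.hatRel_hat_map,
      comp_comp_of_sq (strengthApp_naturality_left st.t (relTensor X Y) Z.rel),
      ← Functor.map_comp_assoc, ← Functor.map_comp_assoc, Category.assoc,
      relTensor_associator, Functor.map_comp_assoc, comp_comp_of_eq (ht X.rel Y.rel Z.rel),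
      tensorHom_def_assoc, ← whisker_exchange_assoc,
      comp_comp_comp_of_eq (relTensor_associator X Y (T.hatObj Z))]
    simp only [Category.assoc]
    rw [comp_comp_of_sq (relTensor_whiskerLeft X (liftedStrength hp T st Y Z)),
      associator_naturality_right_assoc, ← whiskerLeft_comp_assoc, ← whiskerLeft_comp_assoc,
      Category.assoc, relTensor_liftedStrength, whiskerLeft_comp_assoc, whiskerLeft_comp_assoc,
      relTensor_liftedStrength,
      comp_comp_of_sq (strengthApp_naturality_right st.t X.rel (relTensor Y Z)),
      Functor.map_comp_assoc]

/-- The domain `X ⊗ Y` involves no lifting, so the isomorphism `relTensor X Y` serves as test arrow;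
the rest is naturality of `η` at the comparison isomorphisms. -/
theorem whiskerLeft_liftedUnit_liftedStrength (η : TwoArrow (OneArrow.id p) T)
    (hb : ∀ I J, (I ◁ η.b.app J) ≫ strengthApp st.b I J = η.b.app (I ⊗ J))
    (ht : ∀ U V, (U ◁ η.t.app V) ≫ strengthApp st.t U V = η.t.app (U ⊗ V))
    (X Y : DRelCat p) :
    (X ◁ liftedUnit η Y) ≫ liftedStrength hp T st X Y = liftedUnit η (X ⊗ Y) := by
  refine hom_ext_of_isStronglyCocartesian (isStronglyCocartesian_relTensor X Y) ?_ ?_ ?_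
  · simp only [comp_pt, whiskerLeft_pt, liftedStrength_pt, liftedUnit_pt]
    exact hb X.pt Y.pt
  · simp only [comp_der, Category.assoc]
    rw [← cancel_epi (derTensor X Y), comp_comp_of_sq (derTensor_whiskerLeft X (liftedUnit η Y)),
      derTensor_liftedStrength, ← whiskerLeft_comp_assoc, liftedUnit_der_snd, liftedUnit_der_snd]
    refine (comp_comp_of_eq (hb X.D Y.D) _).trans ?_
    exact (η.b.naturality (derTensor X Y)).symm
  · simp only [comp_rel]
    rw [comp_comp_of_sq (relTensor_whiskerLeft X (liftedUnit η Y)), liftedUnit_rel, liftedUnit_rel,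
      whiskerLeft_comp_assoc, relTensor_liftedStrength]
    refine (comp_comp_of_eq (ht X.rel Y.rel) _).trans ?_
    exact (comp_comp_of_sq (η.t.naturality (relTensor X Y)) _).symm

theorem whiskerLeft_liftedMul_liftedStrength (hT : T.IsCocartesian) (μ : TwoArrow (T.comp T) T)
    (hb : ∀ I J, (I ◁ μ.b.app J) ≫ strengthApp st.b I J =
      strengthApp st.b I (T.b.obj J) ≫ T.b.map (strengthApp st.b I J) ≫ μ.b.app (I ⊗ J))
    (ht : ∀ U V, (U ◁ μ.t.app V) ≫ strengthApp st.t U V =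
      strengthApp st.t U (T.t.obj V) ≫ T.t.map (strengthApp st.t U V) ≫ μ.t.app (U ⊗ V))
    (X Y : DRelCat p) :
    (X ◁ liftedMul hT μ Y) ≫ liftedStrength hp T st X Y =
      liftedStrength hp T st X (T.hatObj Y) ≫ T.hat.map (liftedStrength hp T st X Y) ≫
        liftedMul hT μ (X ⊗ Y) := by
  refine hom_ext_of_isStronglyCocartesian (isStronglyCocartesian_whiskerLeft_relTensor X
    (Y := T.hatObj (T.hatObj Y)) hp (isStronglyCocartesian_hatRel_hatRel T T hT Y)) ?_ ?_ ?_
  · simp only [comp_pt, whiskerLeft_pt, liftedStrength_pt, liftedMul_pt]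
    exact hb X.pt Y.pt
  · simp only [comp_der, Category.assoc]
    rw [← cancel_epi (derTensor X (T.hatObj (T.hatObj Y))),
      comp_comp_of_sq (derTensor_whiskerLeft X (liftedMul hT μ Y)),
      derTensor_liftedStrength, ← whiskerLeft_comp_assoc, liftedMul_der_snd, liftedMul_der_snd,
      comp_comp_of_sq (T.hat_map_der_snd (liftedStrength hp T st X Y)),
      comp_comp_comp_of_eq (derTensor_liftedStrength hp T st X (T.hatObj Y))]
    simp only [Category.assoc, whiskerLeft_comp]
    rw [comp_comp_of_eq (hb X.D Y.D), ← Functor.map_comp_assoc, ← Functor.map_comp_assoc,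
      Category.assoc (derTensor _ _), derTensor_liftedStrength, Functor.map_comp_assoc, Functor.map_comp_assoc,
      ← comp_comp_of_sq (strengthApp_naturality_right st.b X.D
        (snd (T.hatObj Y).pt (T.hatObj Y).dist))]
    simp only [Category.assoc]
    -- What remains is naturality of `μ` at `derTensor X Y`.
    exact congrArg (_ ≫ _ ≫ _ ≫ _ ≫ ·) (μ.b.naturality (derTensor X Y)).symm
  · simp only [comp_rel, Category.assoc]
    rw [comp_comp_of_sq (relTensor_whiskerLeft X (liftedMul hT μ Y)), ← whiskerLeft_comp_assoc,
      Category.assoc, hatRel_liftedMul, whiskerLeft_comp_assoc, relTensor_liftedStrength,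
      comp_comp_of_eq (ht X.rel Y.rel), whiskerLeft_comp_assoc,
      comp_comp_comp_of_eq (relTensor_liftedStrength hp T st X (T.hatObj Y))]
    simp only [Category.assoc]
    rw [comp_comp_of_sq (T.hatRel_hat_map (liftedStrength hp T st X Y)),
      comp_comp_of_sq (strengthApp_naturality_right st.t X.rel (T.hatRel Y)),
      ← Functor.map_comp_assoc, ← Functor.map_comp_assoc, Category.assoc,
      relTensor_liftedStrength, Functor.map_comp_assoc, Functor.map_comp_assoc, hatRel_liftedMul]
    refine congrArg (_ ≫ _ ≫ ·) ?_
    exact (comp_comp_of_sq (μ.t.naturality (relTensor X Y)) _).symm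

end StrengthLaws

/-! ### Assembly of the lifted strong monad -/

section StrongMonad

variable {B : Type u₁} [Category.{v₁} B] [CartesianMonoidalCategory B]
variable {E : Type u₂} [Category.{v₂} E] [CartesianMonoidalCategory E]
variable {p : E ⥤ B} [Cleavage p] [Opcleavage p] [StrictFiniteProducts p]

/-- The lifting of a strong monad to differential relations. -/
noncomputable def liftedStrongMonad (hp : ProductPreservesCocartesian p)
    {T : OneArrow p p} (hT : T.IsCocartesian) (M : StrongMonad p T) :
    StrongMonad (GDS p) T.dRel where
  η :=
    { b := M.η.b
      t :=
        { app := fun X => liftedUnit M.η X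
          naturality := fun _ _ f => liftedUnit_naturality M.η f }
      lifts := fun X => (isHomLift_GDS_iff _ _).2 (liftedUnit_pt M.η X) }
  μ :=
    { b := M.μ.b
      t :=
        { app := fun X => liftedMul hT M.μ X
          naturality := fun _ _ f => liftedMul_naturality hT M.μ f }
      lifts := fun X => (isHomLift_GDS_iff _ _).2 (liftedMul_pt hT M.μ X) }
  st :=
    { b := M.st.b
      t :=
        { app := fun X => liftedStrength hp T M.st X.1 X.2
          naturality := fun _ _ f => liftedStrength_naturality hp T M.st f.1 f.2 }
      lifts := fun X => (isHomLift_GDS_iff _ _).2 (liftedStrength_pt hp T M.st X.1 X.2) }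
  isStrongMonad_b := M.isStrongMonad_b
  -- Each law consumes its base version, used on points and on distances, and its version in `E`,
  -- used on relations.
  isStrongMonad_t :=
    { left_unit := liftedUnit_liftedMul M.η hT M.μ M.isStrongMonad_b.left_unit
        M.isStrongMonad_t.left_unit
      right_unit := map_liftedUnit_liftedMul M.η hT M.μ M.isStrongMonad_b.right_unit
        M.isStrongMonad_t.right_unit
      assoc := liftedMul_assoc hT M.μ M.isStrongMonad_b.assoc M.isStrongMonad_t.assoc
      strength_unit := liftedStrength_leftUnitor hp M.st M.isStrongMonad_b.strength_unit
        M.isStrongMonad_t.strength_unit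
      strength_assoc := liftedStrength_associator hp M.st M.isStrongMonad_b.strength_assoc
        M.isStrongMonad_t.strength_assoc
      strength_eta := whiskerLeft_liftedUnit_liftedStrength hp M.st M.η
        M.isStrongMonad_b.strength_eta M.isStrongMonad_t.strength_eta
      strength_mu := whiskerLeft_liftedMul_liftedStrength hp M.st hT M.μ
        M.isStrongMonad_b.strength_mu M.isStrongMonad_t.strength_mu }

end StrongMonad

end DiffRel

theorem mainTheorem4
    {B : Type u₁} [Category.{v₁} B] [CartesianMonoidalCategory B]
    {E : Type u₂} [Category.{v₂} E] [CartesianMonoidalCategory E]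
    (p : E ⥤ B) [Cleavage p] [Opcleavage p] [StrictFiniteProducts p]
    (hp : ProductPreservesCocartesian p)
    (T : OneArrow p p) (hT : T.IsCocartesian) (M : StrongMonad p T) :
    Nonempty (Cleavage (GDS p)) ∧
    (∀ X Y : DRelCat p, IsIso (zeta T X Y) ∧
      (GDS p).IsHomLift (𝟙 (T.b.obj (X.pt ⊗ Y.pt))) (zeta T X Y)) ∧
    (∀ {X X' Y Y' : DRelCat p} (f : X ⟶ X') (g : Y ⟶ Y'),
      (strengthCod T).hat.map (DRelCat.pairMap f g) ≫ zeta T X' Y' =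
        zeta T X Y ≫ T.hat.map (f ⊗ₘ g)) ∧
    (∀ X Y : DRelCat p, IsIso (zeta' hp T X Y) ∧
      (GDS p).IsHomLift (𝟙 (X.pt ⊗ T.b.obj Y.pt)) (zeta' hp T X Y)) ∧
    (∀ {X X' Y Y' : DRelCat p} (f : X ⟶ X') (g : Y ⟶ Y'),
      ((OneArrow.id p).hat.map f ⊗ₘ T.hat.map g) ≫ zeta' hp T X' Y' =
        zeta' hp T X Y ≫ (strengthDom T).hat.map (DRelCat.pairMap f g)) ∧
    ∃ S : StrongMonad (GDS p) T.dRel,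
      S.η.b = M.η.b ∧ S.μ.b = M.μ.b ∧ S.st.b = M.st.b ∧
      (∀ X : DRelCat p, S.η.t.app X = xi X ≫ M.η.hatApp X) ∧
      (∀ X : DRelCat p, S.μ.t.app X = omega T T hT X ≫ M.μ.hatApp X) ∧
      (∀ X Y : DRelCat p, S.st.t.app (X, Y) = liftedStrength hp T M.st X Y) :=
  ⟨⟨cleavageGDS⟩,
    fun X Y => ⟨isIso_zeta T X Y, (isHomLift_GDS_iff _ _).2 rfl⟩,
    fun f g => zeta_naturality T f g,
    fun X Y => ⟨isIso_zeta' hp T X Y, (isHomLift_GDS_iff _ _).2 rfl⟩,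
    fun f g => zeta'_naturality hp T f g,
    liftedStrongMonad hp hT M, rfl, rfl, rfl, fun _ => rfl, fun _ => rfl, fun _ _ => rfl⟩
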